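/- \textbf{Theorem (Regular language recognition).} Let $\Sigma$ be a finite alphabet and $L \subseteq \Sigma^*$ a regular language. There is a log-precision decoder-only transformer with projected pre-norm and strict causal saturated attention, over a finite vocabulary $V$ containing $\Sigma$, a beginning-of-sequence token $\$ \notin \Sigma$ and an accept token $1$, that recognizes $L$ with $|x|+1$ decoding steps on input $\$x$: writing $f : V^* \to V$ for the next-token function of the transformer and $f^0(y) = y$, $f^{k+1}(y) = f^k(y)\cdot f(f^k(y))$, for every $x \in \Sigma^*$ the last token of $f^{|x|+1}(\$x)$ is $1$ if and only if $x \in L$. This holds without positional encodings, and also with positional encodings: for every $k$ and every $g : \mathbb N \to \mathbb R^k$ there is such a transformer whose positional encoding is $g$, placed in $k$ coordinates of the hidden state. Here the transformer has finitely many fixed rational parameters, independent of $x$. On input $\$x$ it is run at precision $p = c\lfloor\log_2 N\rfloor$, where $c$ is a constant depending only on the transformer and $N = 2(|x|+1)$ is the number of input tokens plus decoding steps: values are floats $m\cdot 2^e$ whose mantissa $m$ and exponent $e$ have $\lfloor p/2 \rfloor$ bits each (sign included), and parameters and results of arithmetic operations are truncated towards zero to such floats. Writing $\mathbf h_i$ for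 the hidden state at position $i = 0, 1, \dots$, initially the sum of a token embedding and the positional encoding, each layer computes $$\mathbf o_i = \mathbf W_o \mathbf a_i + \mathbf b_o + \mathbf h_i, \qquad \mathbf h_i' = \mathbf W_2\,\mathrm{ReLU}(\mathbf W_1 \bar{\mathbf o}_i + \mathbf b_1) + \mathbf b_2 + \mathbf o_i ,$$ where $\mathbf a_i$ is the concatenation of the head outputs. Each head at position $i$ averages the values $\mathbf v_j = \mathbf W_v \bar{\mathbf h}_j + \mathbf b_v$ over those $j < i$ that maximize $\mathbf q_i^\top \mathbf k_j/\sqrt{d_{\mathrm{head}}}$ among all $j < i$ (output $\mathbf 0$ if $i = 0$), with $\mathbf q_i = \mathbf W_q \bar{\mathbf h}_i + \mathbf b_q$, $\mathbf k_j = \mathbf W_k \bar{\mathbf h}_j + \mathbf b_k$. Projected pre-norm means $\bar{\mathbf h} = \mathrm{layer\_norm}(\mathbf M \mathbf h)$, $\bar{\mathbf o} = \mathrm{layer\_norm}(\mathbf M' \mathbf o)$ with a parameter matrix for each sublayer, where $\mathrm{layer\_norm}(\mathbf y) = \mathbf y'/\|\mathbf y'\|$, $\mathbf y' = \mathbf y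 - \bar y$, and $\mathrm{layer\_norm}(\mathbf y) = \mathbf 0$ if $\mathbf y' = \mathbf 0$. The next token is one of maximal logit under a linear map of the last layer's hidden state at the last position. -/

import Mathlib

/-! # Decoder-only transformers over `p`-precision floats

A transformer is a fixed, finite list of rational parameters (plus a positional encoding).  It is
run at a precision `p`: all parameters are truncated to `p`-precision floats, and each arithmetic
operation is carried out exactly and then truncated.  Positions are indexed from `0`. -/

/-- The `p`-precision floats `m * 2 ^ e`, where the mantissa `m` and the exponent `e` are signed
integers of `p / 2` bits each. -/
def floats (p : ℕ) : Set ℝ :=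
  {x | ∃ m e : ℤ, |m| < 2 ^ (p / 2 - 1) ∧ |e| < 2 ^ (p / 2 - 1) ∧ x = (m : ℝ) * (2 : ℝ) ^ e}

theorem floats_finite (p : ℕ) : (floats p).Finite := by
  set B : ℤ := 2 ^ (p / 2 - 1)
  refine (((Set.finite_Ioo (-B) B).prod (Set.finite_Ioo (-B) B)).image
    (fun q : ℤ × ℤ => (q.1 : ℝ) * (2 : ℝ) ^ q.2)).subset ?_
  rintro x ⟨m, e, hm, he, rfl⟩
  exact ⟨(m, e), ⟨abs_lt.1 hm, abs_lt.1 he⟩, rfl⟩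

theorem zero_mem_floats (p : ℕ) : (0 : ℝ) ∈ floats p :=
  ⟨0, 0, by simp, by simp, by simp⟩

/-- Truncation towards zero: the float of largest absolute value between `0` and `x`. -/
noncomputable def trunc (p : ℕ) (x : ℝ) : ℝ :=
  if 0 ≤ x then sSup {y | y ∈ floats p ∧ y ≤ x} else -sSup {y | y ∈ floats p ∧ y ≤ -x}

theorem neg_mem_floats {p : ℕ} {x : ℝ} (hx : x ∈ floats p) : -x ∈ floats p := by
  obtain ⟨m, e, hm, he, rfl⟩ := hx
  exact ⟨-m, e, by simpa using hm, he, by push_cast; ring⟩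

/-- Truncation always yields a `p`-precision float. -/
theorem trunc_mem (p : ℕ) (x : ℝ) : trunc p x ∈ floats p := by
  have key : ∀ z : ℝ, 0 ≤ z → sSup {y | y ∈ floats p ∧ y ≤ z} ∈ floats p := fun z hz =>
    (Set.Nonempty.csSup_mem (s := {y | y ∈ floats p ∧ y ≤ z}) ⟨0, zero_mem_floats p, hz⟩
      ((floats_finite p).subset fun _ h => h.1)).1
  unfold trunc
  split_ifs with h
  · exact key x h
  · exact neg_mem_floats (key (-x) (by linarith))

/-- Truncated matrix-vector product, with a matrix of rational parameters. -/
noncomputable def matVec {ι κ : Type} [Fintype κ] (p : ℕ) (W : Matrix ι κ ℚ) (x : κ → ℝ) : ι → ℝ :=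
  fun i => trunc p (∑ j, trunc p (trunc p (W i j : ℝ) * x j))

/-- Truncated affine map `x ↦ W x + b`. -/
noncomputable def affine {ι κ : Type} [Fintype κ] (p : ℕ) (W : Matrix ι κ ℚ) (b : ι → ℚ)
    (x : κ → ℝ) : ι → ℝ :=
  fun i => trunc p (matVec p W x i + trunc p (b i : ℝ))

/-- Truncated inner product. -/
noncomputable def dotFloat {d : ℕ} (p : ℕ) (x y : Fin d → ℝ) : ℝ :=
  trunc p (∑ j, trunc p (x j * y j))

/-- The centred vector `x - mean x`. -/
noncomputable def center {m : ℕ} (p : ℕ) (x : Fin m → ℝ) : Fin m → ℝ :=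
  fun i => trunc p (x i - trunc p (trunc p (∑ j, x j) / trunc p (m : ℝ)))

/-- `layer_norm x = x' / ‖x'‖` with `x' = x - mean x` and the Euclidean norm; it is `0` when
`‖x'‖ = 0`. -/
noncomputable def layerNorm {m : ℕ} (p : ℕ) (x : Fin m → ℝ) : Fin m → ℝ :=
  fun i => trunc p (center p x i / trunc p (Real.sqrt (dotFloat p (center p x) (center p x))))

/-- Projected pre-norm: a linear projection `M`, followed by layer-norm. -/
noncomputable def projLayerNorm {m : ℕ} (p : ℕ) (M : Matrix (Fin m) (Fin m) ℚ) (x : Fin m → ℝ) :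
    Fin m → ℝ :=
  layerNorm p (matVec p M x)

/-- The parameters of a layer with `h` heads of dimension `dh`, model dimension `m` and feedforward
width `w`.  Each of the two sublayers (attention, feedforward) has one projected pre-norm. -/
structure TransformerLayer (m h dh w : ℕ) where
  /-- projection before the layer-norm of the attention sublayer -/
  attnProj : Matrix (Fin m) (Fin m) ℚ
  Wq : Fin h → Matrix (Fin dh) (Fin m) ℚ
  bq : Fin h → Fin dh → ℚ
  Wk : Fin h → Matrix (Fin dh) (Fin m) ℚ
  bk : Fin h → Fin dh → ℚ
  Wv : Fin h → Matrix (Fin dh) (Fin m) ℚ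
  bv : Fin h → Fin dh → ℚ
  /-- output map of the attention sublayer; the columns are those of the concatenated heads -/
  Wo : Matrix (Fin m) (Fin h × Fin dh) ℚ
  bo : Fin m → ℚ
  /-- projection before the layer-norm of the feedforward sublayer -/
  ffProj : Matrix (Fin m) (Fin m) ℚ
  W1 : Matrix (Fin w) (Fin m) ℚ
  b1 : Fin w → ℚ
  W2 : Matrix (Fin m) (Fin w) ℚ
  b2 : Fin m → ℚ

namespace TransformerLayer

variable {m h dh w : ℕ}

/-- Attention logit `⟨q_i, k_j⟩ / √(m / h)` of head `k` between the hidden states `x` (querying)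
and `y` (attended to). -/
noncomputable def score (l : TransformerLayer m h dh w) (p : ℕ) (k : Fin h) (x y : Fin m → ℝ) : ℝ :=
  trunc p (dotFloat p (affine p (l.Wq k) (l.bq k) (projLayerNorm p l.attnProj x))
      (affine p (l.Wk k) (l.bk k) (projLayerNorm p l.attnProj y)) /
    trunc p (Real.sqrt dh))

/-- The value vector of head `k`. -/
noncomputable def value (l : TransformerLayer m h dh w) (p : ℕ) (k : Fin h) (x : Fin m → ℝ) :
    Fin dh → ℝ :=
  affine p (l.Wv k) (l.bv k) (projLayerNorm p l.attnProj x)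

open Classical in
/-- The positions that head `k` attends to from position `i`, under strict causal saturated
attention: those `j < i` with maximal logit.  (No position is attended to from position `0`.) -/
noncomputable def attended (l : TransformerLayer m h dh w) (p : ℕ) (H : ℕ → Fin m → ℝ) (k : Fin h)
    (i : ℕ) : Finset ℕ :=
  (Finset.range i).filter fun j =>
    ∀ j' ∈ Finset.range i, l.score p k (H i) (H j') ≤ l.score p k (H i) (H j)

/-- Output of head `k` at position `i`: the average of the values at the attended positions
(the empty sum `0` at position `0`). -/
noncomputable def head (l : TransformerLayer m h dh w) (p : ℕ) (H : ℕ → Fin m → ℝ) (k : Fin h)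
    (i : ℕ) : Fin dh → ℝ :=
  fun t => trunc p (∑ j ∈ l.attended p H k i,
    trunc p (trunc p (1 / trunc p ((l.attended p H k i).card : ℝ)) * l.value p k (H j) t))

/-- Output of the attention sublayer at position `i`, with the residual connection. -/
noncomputable def attnOut (l : TransformerLayer m h dh w) (p : ℕ) (H : ℕ → Fin m → ℝ) (i : ℕ) :
    Fin m → ℝ :=
  fun t => trunc p (affine p l.Wo l.bo (fun c : Fin h × Fin dh => l.head p H c.1 i c.2) t + H i t)

/-- Feedforward sublayer with ReLU and the residual connection. -/
noncomputable def feedForward (l : TransformerLayer m h dh w) (p : ℕ) (o : Fin m → ℝ) : Fin m → ℝ :=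
  fun t => trunc p (affine p l.W2 l.b2
    (fun s => max 0 (affine p l.W1 l.b1 (projLayerNorm p l.ffProj o) s)) t + o t)

/-- A layer maps the hidden states `H i` at all positions `i` to new hidden states. -/
noncomputable def apply (l : TransformerLayer m h dh w) (p : ℕ) (H : ℕ → Fin m → ℝ) :
    ℕ → Fin m → ℝ :=
  fun i => l.feedForward p (l.attnOut p H i)

end TransformerLayer

/-- A decoder-only projected pre-norm transformer over the vocabulary `V`. -/
structure Transformer (V : Type*) where
  /-- model dimension -/
  m : ℕ
  /-- number of heads -/
  h : ℕ
  /-- head dimension -/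
  dh : ℕ
  /-- feedforward width -/
  w : ℕ
  m_pos : 0 < m
  m_eq : m = h * dh
  /-- token embedding -/
  emb : V → Fin m → ℚ
  /-- positional encoding -/
  pos : ℕ → Fin m → ℝ
  layers : List (TransformerLayer m h dh w)
  /-- the linear output map -/
  out : Matrix V (Fin m) ℚ

namespace Transformer

variable {V : Type*}

/-- Embedding of the token `v` at position `i`. -/
noncomputable def embed (T : Transformer V) (p : ℕ) (v : V) (i : ℕ) : Fin T.m → ℝ :=
  fun t => trunc p (trunc p (T.emb v t : ℝ) + trunc p (T.pos i t))

/-- The embedded word `u`; positions beyond the end of `u` are never attended to. -/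
noncomputable def embedWord (T : Transformer V) (p : ℕ) (u : List V) : ℕ → Fin T.m → ℝ :=
  fun i => if hi : i < u.length then T.embed p u[i] i else 0

/-- The hidden states of the last layer. -/
noncomputable def hidden (T : Transformer V) (p : ℕ) (u : List V) : ℕ → Fin T.m → ℝ :=
  T.layers.foldl (fun H l => l.apply p H) (T.embedWord p u)

/-- The output logit of the token `v`, read off at the last position of the nonempty word `u`. -/
noncomputable def logit (T : Transformer V) (p : ℕ) (u : List V) (v : V) : ℝ :=
  trunc p (∑ t, trunc p (trunc p (T.out v t : ℝ) * T.hidden p u (u.length - 1) t))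

variable [Finite V] [Nonempty V]

/-- One decoding step: a token of maximal logit. -/
noncomputable def next (T : Transformer V) (p : ℕ) (u : List V) : V :=
  (Finite.exists_max (T.logit p u)).choose

/-- The word after `k` decoding steps from `u`: repeatedly append the next token. -/
noncomputable def decode (T : Transformer V) (p : ℕ) : ℕ → List V → List V
  | 0, u => u
  | k + 1, u => T.decode p k u ++ [T.next p (T.decode p k u)]

end Transformer

/-- The vocabulary: the beginning-of-sequence token `$`, the symbols of the input alphabet, the
accept token `1`, and `r` further tokens. -/
inductive Token (α : Type*) (r : ℕ) where
  | bos : Token α r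
  | input : α → Token α r
  | accept : Token α r
  | aux : Fin r → Token α r

instance (α : Type*) (r : ℕ) : Nonempty (Token α r) := ⟨Token.bos⟩

instance (α : Type*) [Finite α] (r : ℕ) : Finite (Token α r) := by
  refine Finite.of_surjective
    (fun s : Option (Option (α ⊕ Fin r)) => match s with
      | none => Token.bos
      | some none => Token.accept
      | some (some (Sum.inl a)) => Token.input a
      | some (some (Sum.inr q)) => Token.aux q) ?_
  rintro (_ | a | _ | q)
  exacts [⟨none, rfl⟩, ⟨some (some (Sum.inl a)), rfl⟩, ⟨some none, rfl⟩,
    ⟨some (some (Sum.inr q)), rfl⟩]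

namespace Transformer

/-- `T` recognizes `L` with `|x| + 1` decoding steps and precision `c log₂ N`, where `N` is the
number of input tokens plus the number of decoding steps: for each word `x`, the last token
generated from `$x` in `|x| + 1` decoding steps is the accept token iff `x ∈ L`. -/
def RecognizesInLinearSteps {α : Type*} [Finite α] {r : ℕ} (T : Transformer (Token α r)) (c : ℕ)
    (L : Language α) : Prop :=
  ∀ x : List α,
    (T.decode (c * Nat.log 2 ((x.length + 1) + (x.length + 1))) (x.length + 1)
      (Token.bos :: x.map Token.input)).getLast? = some Token.accept ↔ x ∈ L

/-- `T` has the positional encoding `pe`, placed in the first `k` coordinates of the model. -/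
def HasPositionalEncoding {V : Type*} (T : Transformer V) {k : ℕ} (pe : ℕ → Fin k → ℝ) : Prop :=
  k ≤ T.m ∧ ∀ i t, T.pos i t = if ht : (t : ℕ) < k then pe i ⟨t, ht⟩ else 0

end Transformer

/-! The transformer writes out the run of a finite automaton `M` whose states are coded as auxiliary
tokens. After `$ x₁ … xₙ` it emits the start state, and then at each step the state reached by
reading one more letter. In the step where the whole input has been read, it emits the accept token
instead if that state is accepting. The current state is the last token, so a step only needs the
next letter. When `s ≥ 1` states have been emitted, this letter sits at position `s`. The difficulty
is to find it without positional information and in truncated arithmetic.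

The first layer attends uniformly and records the frequencies of `$`, of non-input tokens and of
input tokens among the preceding positions. At an input position `j` the first two are both `1/j`;
at the last position `n + s` they are `1/(n+s)` and `s/(n+s)`. Using the constant `1` supplied by
the one-hot token, layer-norm makes the key at `j` a multiple, independent of `j`, of the unit
vector along `(1, 1, j)`, while the query is a positive multiple of `(1, 1, s)`. By Cauchy–Schwarz
the inner product is largest exactly for `j = s`; `direction_gap` makes this quantitative, other
tokens are penalized, and `Trace.dotAt_gap` and `Trace.stepLayer_attended` conclude. The feedforward
sublayer tabulates the transition function with one ReLU gate per pair of state and letter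
(`stepLayer_gate`, `nextState_aux`). The output map decides between the new state and the accept
token by the sign of `(2(n - s) - 1)/(n + s)`, a combination of the three frequencies
(`Trace.progress_pos`, `Trace.progress_neg`).

The quantities whose errors matter stay below `2 ^ 7`, so each truncation costs at most `err p`. All
margins are polynomial in `1/N`, hence a constant multiple of `log₂ N` bits suffices
(`exists_precise`). -/

/-! ## Truncation -/

section Trunc

variable {p : ℕ} {x y f : ℝ}

theorem bddAbove_floats_le (p : ℕ) (x : ℝ) : BddAbove {y | y ∈ floats p ∧ y ≤ x} :=
  ⟨x, fun _ h => h.2⟩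

theorem trunc_of_mem (hx : x ∈ floats p) : trunc p x = x := by
  have key : ∀ z ∈ floats p, sSup {y | y ∈ floats p ∧ y ≤ z} = z := fun z hz =>
    IsGreatest.csSup_eq ⟨⟨hz, le_rfl⟩, fun _ h => h.2⟩
  unfold trunc
  split_ifs
  · exact key x hx
  · rw [key (-x) (neg_mem_floats hx), neg_neg]

@[simp] theorem trunc_zero (p : ℕ) : trunc p 0 = 0 := trunc_of_mem (zero_mem_floats p)

@[simp] theorem trunc_trunc (p : ℕ) (x : ℝ) : trunc p (trunc p x) = trunc p x :=
  trunc_of_mem (trunc_mem p x)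

@[simp] theorem trunc_neg (p : ℕ) (x : ℝ) : trunc p (-x) = -trunc p x := by
  rcases lt_trichotomy x 0 with h | rfl | h
  · rw [trunc, trunc, if_pos (by linarith), if_neg (by linarith), neg_neg]
  · simp
  · rw [trunc, trunc, if_neg (by linarith), if_pos h.le, neg_neg]

theorem trunc_nonneg (hx : 0 ≤ x) : 0 ≤ trunc p x := by
  rw [trunc, if_pos hx]
  exact le_csSup (bddAbove_floats_le p x) ⟨zero_mem_floats p, hx⟩

theorem trunc_le (hx : 0 ≤ x) : trunc p x ≤ x := by
  rw [trunc, if_pos hx]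
  exact csSup_le ⟨0, zero_mem_floats p, hx⟩ fun _ h => h.2

theorem trunc_mono_of_nonneg (hx : 0 ≤ x) (hxy : x ≤ y) : trunc p x ≤ trunc p y := by
  rw [trunc, if_pos hx, trunc, if_pos (hx.trans hxy)]
  exact csSup_le_csSup (bddAbove_floats_le p y) ⟨0, zero_mem_floats p, hx⟩
    fun _ h => ⟨h.1, h.2.trans hxy⟩

theorem trunc_mono (p : ℕ) : Monotone (trunc p) := by
  intro x y hxy
  rcases le_total 0 x with hx | hx
  · exact trunc_mono_of_nonneg hx hxy
  · have h1 : 0 ≤ trunc p (-x) := trunc_nonneg (by linarith)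
    rw [trunc_neg] at h1
    rcases le_total 0 y with hy | hy
    · linarith [trunc_nonneg (p := p) hy]
    · have := trunc_mono_of_nonneg (p := p) (x := -y) (y := -x) (by linarith) (by linarith)
      rw [trunc_neg, trunc_neg] at this
      linarith

theorem le_trunc (hf : f ∈ floats p) (h : f ≤ x) : f ≤ trunc p x := by
  simpa [trunc_of_mem hf] using trunc_mono p h

theorem trunc_le_of_le (hf : f ∈ floats p) (h : x ≤ f) : trunc p x ≤ f := by
  simpa [trunc_of_mem hf] using trunc_mono p h

/-- Integer multiples of `2 ^ (-a)` with a small mantissa are floats. -/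
theorem div_pow_mem_floats {z : ℤ} {a : ℕ} (ha : a ≤ p / 2 - 1) (hz : |z| < 2 ^ (p / 2 - 1)) :
    (z : ℝ) / 2 ^ a ∈ floats p := by
  refine ⟨z, -a, hz, ?_, by simp [zpow_neg, div_eq_mul_inv]⟩
  rw [abs_neg, Nat.abs_cast]
  exact_mod_cast ha.trans_lt Nat.lt_two_pow_self

theorem intCast_mem_floats {z : ℤ} (hz : |z| < 2 ^ (p / 2 - 1)) : (z : ℝ) ∈ floats p := by
  simpa using div_pow_mem_floats (a := 0) (Nat.zero_le _) hz

theorem natCast_mem_floats {z : ℕ} (hz : z < 2 ^ (p / 2 - 1)) : (z : ℝ) ∈ floats p := by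
  have := intCast_mem_floats (p := p) (z := z) (by rw [Nat.abs_cast]; exact_mod_cast hz)
  simpa using this

/-- The absolute error of truncating a number below `2 ^ 7`. -/
noncomputable def err (p : ℕ) : ℝ := 2 ^ 7 / 2 ^ (p / 2 - 1)

theorem err_pos (p : ℕ) : 0 < err p := by unfold err; positivity

/-- Write `p / 2 - 1 = 7 + a`. Rounding `x` down to a multiple of `2 ^ (-a)` gives a mantissa below
`2 ^ (7 + a)`, hence a float within `2 ^ (-a) = err p` of `x`. -/
theorem sub_err_le_trunc (hp : 7 ≤ p / 2 - 1) (hx : 0 ≤ x) (hx' : x < 2 ^ 7) :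
    x - err p ≤ trunc p x := by
  obtain ⟨a, ha⟩ := Nat.exists_eq_add_of_le hp
  have herr : err p = 1 / 2 ^ a := by
    rw [err, ha, pow_add]; field_simp
  have h2 : (0 : ℝ) < 2 ^ a := by positivity
  have hfl : (⌊x * 2 ^ a⌋ : ℝ) ≤ x * 2 ^ a := Int.floor_le _
  have hfl' : x * 2 ^ a - 1 < (⌊x * 2 ^ a⌋ : ℝ) := Int.sub_one_lt_floor _
  have h0 : 0 ≤ ⌊x * 2 ^ a⌋ := Int.floor_nonneg.2 (by positivity)
  have hmem : (⌊x * 2 ^ a⌋ : ℝ) / 2 ^ a ∈ floats p := by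
    refine div_pow_mem_floats (by omega) ?_
    rw [abs_of_nonneg h0, Int.floor_lt, ha, pow_add]
    push_cast
    nlinarith
  refine le_trans ?_ (le_trunc hmem ((div_le_iff₀ h2).2 hfl))
  rw [herr, le_div_iff₀ h2, sub_mul, one_div, inv_mul_cancel₀ h2.ne']
  exact hfl'.le

theorem abs_trunc_sub_le (hp : 7 ≤ p / 2 - 1) (hx : |x| < 2 ^ 7) : |trunc p x - x| ≤ err p := by
  rcases le_total 0 x with h | h
  · rw [abs_of_nonneg h] at hx
    rw [abs_le]
    constructor <;> linarith [sub_err_le_trunc hp h hx, trunc_le (p := p) h, err_pos p]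
  · rw [abs_of_nonpos h] at hx
    have h1 := sub_err_le_trunc hp (x := -x) (by linarith) hx
    have h2 := trunc_le (p := p) (x := -x) (by linarith)
    rw [trunc_neg] at h1 h2
    rw [abs_le]
    constructor <;> linarith [err_pos p]

theorem one_mem_floats (hp : 7 ≤ p / 2 - 1) : (1 : ℝ) ∈ floats p := by
  have := natCast_mem_floats (p := p) (z := 1) (Nat.one_lt_two_pow (by omega))
  simpa using this

theorem ofNat_mem_floats (hp : 7 ≤ p / 2 - 1) (z : ℕ) [z.AtLeastTwo] (hz : z < 2 ^ 7) :
    (OfNat.ofNat z : ℝ) ∈ floats p :=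
  natCast_mem_floats (hz.trans_le (Nat.pow_le_pow_right (by norm_num) hp))

theorem one_div_pow_mem_floats (hp : 7 ≤ p / 2 - 1) {a : ℕ} (ha : a ≤ 7) :
    (1 : ℝ) / 2 ^ a ∈ floats p := by
  have := div_pow_mem_floats (p := p) (z := 1) (a := a) (by omega)
    (by simpa using one_lt_pow₀ (by norm_num : (1 : ℤ) < 2) (by omega : p / 2 - 1 ≠ 0))
  simpa using this

theorem trunc_one (hp : 7 ≤ p / 2 - 1) : trunc p 1 = 1 := trunc_of_mem (one_mem_floats hp)

theorem trunc_ofNat (hp : 7 ≤ p / 2 - 1) (z : ℕ) [z.AtLeastTwo] (hz : z < 2 ^ 7) :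
    trunc p (OfNat.ofNat z : ℝ) = OfNat.ofNat z :=
  trunc_of_mem (ofNat_mem_floats hp z hz)

theorem trunc_lt_trunc (hp : 7 ≤ p / 2 - 1) (hx : |x| < 2 ^ 7) (hy : |y| < 2 ^ 7)
    (h : 2 * err p < y - x) : trunc p x < trunc p y := by
  have h1 := abs_le.1 (abs_trunc_sub_le hp hx)
  have h2 := abs_le.1 (abs_trunc_sub_le hp hy)
  linarith [h1.2, h2.1]

end Trunc

/-! ## Layers acting on a block of coordinates

The hidden states below consist of `k` coordinates for the positional encoding, which are never
read, and of four copies of a block `β` of coordinates.  Only the first copy stores information;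
the projections before the layer-norms fill the four copies with the signs `+, +, -, -`, so that
the mean of the projected vector is exactly `0`. -/

section Block

variable {β : Type*} [Fintype β] {k : ℕ}

/-- Model dimension: `k` positional coordinates and four copies of the block `β`. -/
abbrev blockDim (k : ℕ) (β : Type*) [Fintype β] : ℕ := k + Fintype.card (β × Fin 4)

/-- The coordinates of the model. -/
noncomputable def blockEquiv (k : ℕ) (β : Type*) [Fintype β] :
    Fin k ⊕ (β × Fin 4) ≃ Fin (blockDim k β) :=
  (Equiv.sumCongr (Equiv.refl _) (Fintype.equivFin (β × Fin 4))).trans finSumFinEquiv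

/-- The coordinate of the first copy of `b`. -/
noncomputable def coord (k : ℕ) (b : β) : Fin (blockDim k β) := blockEquiv k β (Sum.inr (b, 0))

theorem not_coord_lt (b : β) : ¬ (coord k b : ℕ) < k := by
  simp [coord, blockEquiv]

/-- The signs of the four copies. -/
def copySign : Fin 4 → ℚ := ![1, 1, -1, -1]

/-- A linear functional that reads the first copy. -/
noncomputable def liftRow (k : ℕ) (r : β → ℚ) : Fin (blockDim k β) → ℚ := fun t =>
  Sum.elim (fun _ => 0) (fun bs => if bs.2 = 0 then r bs.1 else 0) ((blockEquiv k β).symm t)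

/-- A family of functionals, written to the first copy. -/
noncomputable def liftMat (k : ℕ) {ι : Type*} (W : β → ι → ℚ) :
    Fin (blockDim k β) → ι → ℚ := fun t =>
  Sum.elim (fun _ => 0) (fun bs => if bs.2 = 0 then W bs.1 else 0) ((blockEquiv k β).symm t)

/-- A family of functionals, written to the four copies with signs. -/
noncomputable def liftProj (k : ℕ) (L : β → β → ℚ) :
    Matrix (Fin (blockDim k β)) (Fin (blockDim k β)) ℚ := fun t =>
  Sum.elim (fun _ => 0) (fun bs => copySign bs.2 • liftRow k (L bs.1)) ((blockEquiv k β).symm t)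

theorem sum_block (f : Fin (blockDim k β) → ℝ) :
    ∑ t, f t = ∑ t, f (blockEquiv k β (Sum.inl t)) +
      ∑ b, ∑ s, f (blockEquiv k β (Sum.inr (b, s))) := by
  rw [← (blockEquiv k β).sum_comp, Fintype.sum_sum_type, Fintype.sum_prod_type]

/-- A sum over the coordinates in which only the first copy contributes. -/
theorem sum_first_copy (f : Fin (blockDim k β) → ℝ)
    (h0 : ∀ t, f (blockEquiv k β (Sum.inl t)) = 0)
    (h1 : ∀ b s, s ≠ 0 → f (blockEquiv k β (Sum.inr (b, s))) = 0) :
    ∑ t, f t = ∑ b, f (coord k b) := by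
  rw [sum_block, Finset.sum_eq_zero fun t _ => h0 t, zero_add]
  exact Finset.sum_congr rfl fun b _ => Fintype.sum_eq_single 0 fun s hs => h1 b s hs

/-- Truncated evaluation of a linear functional. -/
noncomputable def rowEval {κ : Type*} [Fintype κ] (p : ℕ) (r : κ → ℚ) (x : κ → ℝ) : ℝ :=
  trunc p (∑ j, trunc p (trunc p (r j : ℝ) * x j))

/-- Layer-norm of the vector that consists of four signed copies of `z`, on the first copy. -/
noncomputable def blockNorm (p : ℕ) (z : β → ℝ) (b : β) : ℝ :=
  trunc p (z b / trunc p (√(trunc p (4 * ∑ b', trunc p (z b' * z b')))))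

/-- Projected layer-norm on the first copy. -/
noncomputable def projBlockNorm (p : ℕ) (L : β → β → ℚ) (x : β → ℝ) : β → ℝ :=
  blockNorm p fun b => rowEval p (L b) x

variable {p : ℕ}

@[simp] theorem rowEval_zero {κ : Type*} [Fintype κ] (x : κ → ℝ) :
    rowEval p (fun _ => 0) x = 0 := by simp [rowEval]

@[simp] theorem rowEval_zero_apply {κ : Type*} [Fintype κ] (x : κ → ℝ) :
    rowEval p 0 x = 0 := rowEval_zero x

@[simp] theorem trunc_rowEval {κ : Type*} [Fintype κ] (r : κ → ℚ) (x : κ → ℝ) :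
    trunc p (rowEval p r x) = rowEval p r x := by simp [rowEval]

theorem matVec_eq_rowEval {ι κ : Type} [Fintype κ] (W : Matrix ι κ ℚ) (x : κ → ℝ) (i : ι) :
    matVec p W x i = rowEval p (W i) x := rfl

theorem affine_zero {ι κ : Type} [Fintype κ] (W : Matrix ι κ ℚ) (x : κ → ℝ) (i : ι) :
    affine p W (fun _ => 0) x i = rowEval p (W i) x := by
  simp [affine, matVec_eq_rowEval]

theorem rowEval_liftRow (r : β → ℚ) (x : Fin (blockDim k β) → ℝ) :
    rowEval p (liftRow k r) x = rowEval p r fun b => x (coord k b) := by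
  unfold rowEval
  rw [sum_first_copy]
  · simp [liftRow, coord]
  · simp [liftRow]
  · intro b s hs
    simp [liftRow, hs]

theorem rowEval_liftMat {ι : Type*} [Fintype ι] (W : β → ι → ℚ) (x : ι → ℝ) (b : β) :
    rowEval p (liftMat k W (coord k b)) x = rowEval p (W b) x := by
  simp [liftMat, coord]

theorem matVec_liftProj_inl (L : β → β → ℚ) (x : Fin (blockDim k β) → ℝ) (t : Fin k) :
    matVec p (liftProj k L) x (blockEquiv k β (Sum.inl t)) = 0 := by
  simp [matVec_eq_rowEval, liftProj]

theorem matVec_liftProj_inr (L : β → β → ℚ) (x : Fin (blockDim k β) → ℝ) (b : β) (s : Fin 4) :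
    matVec p (liftProj k L) x (blockEquiv k β (Sum.inr (b, s))) =
      copySign s * rowEval p (L b) fun b => x (coord k b) := by
  rw [← rowEval_liftRow]
  have hs : copySign s = 1 ∨ copySign s = -1 := by
    fin_cases s <;> simp [copySign]
  rcases hs with hs | hs <;> simp [matVec_eq_rowEval, liftProj, hs, rowEval]

/-- The signed copies cancel exactly because sums are truncated only at the end, so centring changes
nothing. Four copies are used rather than two so that a one-hot vector has norm `√4 = 2`, which is a
float. -/
theorem projLayerNorm_liftProj (L : β → β → ℚ) (x : Fin (blockDim k β) → ℝ) (b : β) :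
    projLayerNorm p (liftProj k L) x (coord k b) =
      projBlockNorm p L (fun b => x (coord k b)) b := by
  set y := matVec p (liftProj k L) x with hy
  have hmean : ∑ t, y t = 0 := by
    rw [sum_block]
    simp [hy, matVec_liftProj_inl, matVec_liftProj_inr, Fin.sum_univ_four, copySign]
  have hcenter : center p y = y := by
    funext t
    simp [center, hmean]
    simp [hy, matVec_eq_rowEval]
  have hdot : dotFloat p y y = trunc p (4 * ∑ b', trunc p
      ((rowEval p (L b') fun b => x (coord k b)) * (rowEval p (L b') fun b => x (coord k b)))) := by
    rw [dotFloat, sum_block, Finset.mul_sum]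
    simp [hy, matVec_liftProj_inl, matVec_liftProj_inr, Fin.sum_univ_four, copySign]
    congr 1
    refine Finset.sum_congr rfl fun b _ => ?_
    ring
  have hyb : y (coord k b) = rowEval p (L b) fun b => x (coord k b) := by
    rw [hy, coord, matVec_liftProj_inr]
    simp [copySign]
  rw [projLayerNorm, layerNorm, ← hy, hcenter, hdot, hyb, projBlockNorm, blockNorm]

/-- The parameters of a layer with one head that acts on the block `β`, with feedforward width
`γ`. -/
structure BlockLayer (β γ : Type*) where
  attnProj : β → β → ℚ
  Wq : β → β → ℚ
  Wk : β → β → ℚ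
  Wv : β → β → ℚ
  ffProj : β → β → ℚ
  W1 : γ → β → ℚ
  W2 : β → γ → ℚ

namespace BlockLayer

variable {γ : Type*} [Fintype γ]

/-- The transformer layer given by a block layer. -/
noncomputable def toLayer (k : ℕ) (l : BlockLayer β γ) :
    TransformerLayer (blockDim k β) 1 (blockDim k β) (Fintype.card γ) where
  attnProj := liftProj k l.attnProj
  Wq _ := liftMat k fun b => liftRow k (l.Wq b)
  bq _ _ := 0
  Wk _ := liftMat k fun b => liftRow k (l.Wk b)
  bk _ _ := 0
  Wv _ := liftMat k fun b => liftRow k (l.Wv b)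
  bv _ _ := 0
  Wo := fun t c => if t = c.2 then 1 else 0
  bo _ := 0
  ffProj := liftProj k l.ffProj
  W1 := fun s => liftRow k (l.W1 ((Fintype.equivFin γ).symm s))
  b1 _ := 0
  W2 := liftMat k fun b s => l.W2 b ((Fintype.equivFin γ).symm s)
  b2 _ := 0

/-- The attention logit, up to the factor `√dh`. -/
noncomputable def dot (l : BlockLayer β γ) (p : ℕ) (x y : β → ℝ) : ℝ :=
  ∑ b, trunc p (rowEval p (l.Wq b) (projBlockNorm p l.attnProj x) *
    rowEval p (l.Wk b) (projBlockNorm p l.attnProj y))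

/-- The feedforward activations. -/
noncomputable def gate (l : BlockLayer β γ) (p : ℕ) (x : β → ℝ) (g : γ) : ℝ :=
  max 0 (rowEval p (l.W1 g) (projBlockNorm p l.ffProj x))

variable (l : BlockLayer β γ)

theorem affine_query (x : Fin (blockDim k β) → ℝ) (a : Fin 1) (t : Fin (blockDim k β)) :
    affine p ((l.toLayer k).Wq a) ((l.toLayer k).bq a) x t =
      rowEval p (liftMat k (fun b => liftRow k (l.Wq b)) t) x := affine_zero _ x t

theorem affine_key (x : Fin (blockDim k β) → ℝ) (a : Fin 1) (t : Fin (blockDim k β)) :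
    affine p ((l.toLayer k).Wk a) ((l.toLayer k).bk a) x t =
      rowEval p (liftMat k (fun b => liftRow k (l.Wk b)) t) x := affine_zero _ x t

theorem affine_value (x : Fin (blockDim k β) → ℝ) (a : Fin 1) (t : Fin (blockDim k β)) :
    affine p ((l.toLayer k).Wv a) ((l.toLayer k).bv a) x t =
      rowEval p (liftMat k (fun b => liftRow k (l.Wv b)) t) x := affine_zero _ x t

theorem affine_out (x : Fin 1 × Fin (blockDim k β) → ℝ) (t : Fin (blockDim k β)) :
    affine p (l.toLayer k).Wo (l.toLayer k).bo x t =
      rowEval p (fun c : Fin 1 × Fin (blockDim k β) => if t = c.2 then 1 else 0) x :=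
  affine_zero _ x t

theorem affine_W1 (x : Fin (blockDim k β) → ℝ) (s : Fin (Fintype.card γ)) :
    affine p (l.toLayer k).W1 (l.toLayer k).b1 x s =
      rowEval p (liftRow k (l.W1 ((Fintype.equivFin γ).symm s))) x := affine_zero _ x s

theorem affine_W2 (x : Fin (Fintype.card γ) → ℝ) (t : Fin (blockDim k β)) :
    affine p (l.toLayer k).W2 (l.toLayer k).b2 x t =
      rowEval p (liftMat k (fun b s => l.W2 b ((Fintype.equivFin γ).symm s)) t) x :=
  affine_zero _ x t

theorem projLayerNorm_attnProj (x : Fin (blockDim k β) → ℝ) (b : β) :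
    projLayerNorm p (l.toLayer k).attnProj x (coord k b) =
      projBlockNorm p l.attnProj (fun b => x (coord k b)) b := projLayerNorm_liftProj _ x b

theorem projLayerNorm_ffProj (x : Fin (blockDim k β) → ℝ) (b : β) :
    projLayerNorm p (l.toLayer k).ffProj x (coord k b) =
      projBlockNorm p l.ffProj (fun b => x (coord k b)) b := projLayerNorm_liftProj _ x b

theorem score_toLayer (x y : Fin (blockDim k β) → ℝ) (a : Fin 1) :
    (l.toLayer k).score p a x y =
      trunc p (trunc p (l.dot p (fun b => x (coord k b)) fun b => y (coord k b)) /
        trunc p √(blockDim k β : ℝ)) := by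
  unfold TransformerLayer.score dotFloat dot
  congr 3
  simp only [affine_query, affine_key]
  rw [sum_first_copy]
  · simp only [rowEval_liftMat, rowEval_liftRow, projLayerNorm_attnProj]
  · intro t
    simp [liftMat]
  · intro b s hs
    simp [liftMat, hs]

theorem value_toLayer (x : Fin (blockDim k β) → ℝ) (a : Fin 1) (b : β) :
    (l.toLayer k).value p a x (coord k b) =
      rowEval p (l.Wv b) (projBlockNorm p l.attnProj fun b => x (coord k b)) := by
  simp only [TransformerLayer.value, affine_value, rowEval_liftMat, rowEval_liftRow,
    projLayerNorm_attnProj]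

theorem head_toLayer (H : ℕ → Fin (blockDim k β) → ℝ) (a : Fin 1) (i : ℕ) (b : β) :
    (l.toLayer k).head p H a i (coord k b) =
      trunc p (∑ j ∈ (l.toLayer k).attended p H a i,
        trunc p (trunc p (1 / trunc p (((l.toLayer k).attended p H a i).card : ℝ)) *
          rowEval p (l.Wv b) (projBlockNorm p l.attnProj fun b => H j (coord k b)))) := by
  simp only [TransformerLayer.head, value_toLayer]

theorem attnOut_toLayer (hp : 7 ≤ p / 2 - 1) (H : ℕ → Fin (blockDim k β) → ℝ) (i : ℕ)
    (t : Fin (blockDim k β)) :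
    (l.toLayer k).attnOut p H i t = trunc p ((l.toLayer k).head p H 0 i t + H i t) := by
  unfold TransformerLayer.attnOut
  congr 2
  have h1 : ∀ c : Fin 1 × Fin (blockDim k β), c ≠ (0, t) → c.2 ≠ t := by
    rintro ⟨a, t'⟩ h rfl
    exact h (by rw [Subsingleton.elim a 0])
  rw [affine_out, rowEval, Fintype.sum_eq_single (0, t)]
  · simp [trunc_one hp, TransformerLayer.head]
  · intro c hc
    simp [(h1 c hc).symm]

theorem feedForward_toLayer (x : Fin (blockDim k β) → ℝ) (b : β) :
    (l.toLayer k).feedForward p x (coord k b) =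
      trunc p (rowEval p (l.W2 b) (l.gate p fun b => x (coord k b)) + x (coord k b)) := by
  unfold TransformerLayer.feedForward
  congr 2
  rw [affine_W2, rowEval_liftMat]
  simp only [affine_W1, rowEval_liftRow, projLayerNorm_ffProj]
  unfold rowEval gate
  rw [← (Fintype.equivFin γ).sum_comp]
  simp [rowEval]

end BlockLayer

end Block

/-! ## The recognizer of a finite automaton -/

/-- The tokens of the input alphabet. -/
def Token.IsInput {α : Type*} {r : ℕ} : Token α r → Prop
  | Token.input _ => True
  | _ => False

/-- The coordinates of the recognizer: the frequencies of the token `$`, of the tokens outside the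
input alphabet, and of the input tokens among the preceding positions; the current token; the
symbol that is looked up; and the next state. -/
inductive RegCoord (α : Type*) (r : ℕ) where
  | bosFreq : RegCoord α r
  | otherFreq : RegCoord α r
  | inputFreq : RegCoord α r
  | tok : Token α r → RegCoord α r
  | sym : α → RegCoord α r
  | res : Fin r → RegCoord α r

section Recognizer

open Classical

variable {α : Type*} {r : ℕ} {p : ℕ}

/-- A vector that is supported at the token `u`. -/
noncomputable def oneHot (u : Token α r) (g : ℝ) : Token α r → ℝ := Pi.single u g

theorem oneHot_self (u : Token α r) (g : ℝ) : oneHot u g u = g := by simp [oneHot]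

theorem map_oneHot (u : Token α r) (g : ℝ) (f : ℝ → ℝ) (hf : f 0 = 0) :
    (fun v => f (oneHot u g v)) = oneHot u (f g) := by
  funext v
  by_cases hv : v = u
  · subst hv; simp [oneHot]
  · simp [oneHot, hv, hf]

/-- The number of positions before `i` whose token satisfies `S`. -/
noncomputable def countBefore (S : Token α r → Prop) (tk : ℕ → Token α r) (i : ℕ) : ℕ :=
  ((Finset.range i).filter fun j => S (tk j)).card

/-- The truncated weight of one out of `i` positions. -/
noncomputable def weight (p i : ℕ) : ℝ := trunc p (1 / trunc p (i : ℝ))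

/-- The frequency, as computed by the first layer, of tokens satisfying `S` before position `i`. -/
noncomputable def freq (p : ℕ) (S : Token α r → Prop) (tk : ℕ → Token α r) (i : ℕ) : ℝ :=
  trunc p (countBefore S tk i * weight p i)

theorem freq_eq (S : Token α r → Prop) (tk : ℕ → Token α r) (i : ℕ) :
    trunc p (∑ j ∈ Finset.range i, trunc p (weight p i * if S (tk j) then 1 else 0)) =
      freq p S tk i := by
  have h : ∀ j, trunc p (weight p i * if S (tk j) then 1 else 0) =
      if S (tk j) then weight p i else 0 := by
    intro j
    split_ifs <;> simp [weight]
  rw [Finset.sum_congr rfl fun j _ => h j, ← Finset.sum_filter, Finset.sum_const, nsmul_eq_mul,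
    freq, countBefore]

theorem freq_mem (S : Token α r → Prop) (tk : ℕ → Token α r) (i : ℕ) :
    freq p S tk i ∈ floats p := trunc_mem _ _

variable [Fintype α]

noncomputable instance (α : Type*) [Fintype α] (r : ℕ) : Fintype (Token α r) := Fintype.ofFinite _

namespace RegCoord

/-- A function of the coordinates, by cases. -/
def ofParts {X : Type*} (a b c : X) (t : Token α r → X) (s : α → X) (z : Fin r → X) :
    RegCoord α r → X
  | bosFreq => a
  | otherFreq => b
  | inputFreq => c
  | tok v => t v
  | sym x => s x
  | res q => z q

/-- The coordinates as an iterated sum. -/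
def equivSum (α : Type*) (r : ℕ) :
    RegCoord α r ≃ Option (Option (Option (Token α r ⊕ α ⊕ Fin r))) where
  toFun := ofParts none (some none) (some (some none)) (fun v => some (some (some (Sum.inl v))))
    (fun a => some (some (some (Sum.inr (Sum.inl a)))))
    (fun q => some (some (some (Sum.inr (Sum.inr q)))))
  invFun
    | none => bosFreq
    | some none => otherFreq
    | some (some none) => inputFreq
    | some (some (some (Sum.inl v))) => tok v
    | some (some (some (Sum.inr (Sum.inl a)))) => sym a
    | some (some (some (Sum.inr (Sum.inr q)))) => res q
  left_inv := by rintro (_ | _ | _ | _ | _ | _) <;> rfl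
  right_inv := by rintro (_ | _ | _ | _ | _ | _) <;> rfl

noncomputable instance : Fintype (RegCoord α r) := Fintype.ofEquiv _ (equivSum α r).symm

theorem sum_eq (f : RegCoord α r → ℝ) : ∑ b, f b = f bosFreq + f otherFreq + f inputFreq +
    ∑ v, f (tok v) + ∑ a, f (sym a) + ∑ q, f (res q) := by
  rw [← (equivSum α r).symm.sum_comp]
  simp only [Fintype.sum_option, Fintype.sum_sum_type]
  simp only [equivSum, Equiv.coe_fn_symm_mk]
  ring

theorem rowEval_ofParts (wa wb wc : ℚ) (wt : Token α r → ℚ) (ws : α → ℚ) (wz : Fin r → ℚ)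
    (a b c : ℝ) (t : Token α r → ℝ) (s : α → ℝ) (z : Fin r → ℝ) :
    rowEval p (ofParts wa wb wc wt ws wz) (ofParts a b c t s z) =
      trunc p (trunc p (trunc p wa * a) + trunc p (trunc p wb * b) + trunc p (trunc p wc * c) +
        ∑ v, trunc p (trunc p (wt v) * t v) + ∑ x, trunc p (trunc p (ws x) * s x) +
        ∑ q, trunc p (trunc p (wz q) * z q)) := by
  rw [rowEval, sum_eq]
  rfl

theorem blockNorm_ofParts (a b c : ℝ) (t : Token α r → ℝ) (s : α → ℝ) (z : Fin r → ℝ) {ρ : ℝ}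
    (hρ : trunc p √(trunc p (4 * (trunc p (a * a) + trunc p (b * b) + trunc p (c * c) +
      ∑ v, trunc p (t v * t v) + ∑ x, trunc p (s x * s x) + ∑ q, trunc p (z q * z q)))) = ρ) :
    blockNorm p (ofParts a b c t s z) =
      ofParts (trunc p (a / ρ)) (trunc p (b / ρ)) (trunc p (c / ρ)) (fun v => trunc p (t v / ρ))
        (fun x => trunc p (s x / ρ)) (fun q => trunc p (z q / ρ)) := by
  subst hρ
  funext d
  rw [blockNorm, sum_eq]
  cases d <;> rfl

end RegCoord

open RegCoord

/-- A functional that only reads the current token. -/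
def tokRow (w : Token α r → ℚ) : RegCoord α r → ℚ := ofParts 0 0 0 w 0 0

/-- The first layer computes the frequencies. -/
noncomputable def countLayer (α : Type*) (r : ℕ) : BlockLayer (RegCoord α r) (Fin r × α) where
  attnProj := ofParts 0 0 0 (fun v => tokRow (Pi.single v 1)) 0 0
  Wq := 0
  Wk := 0
  -- Layer-norm scales the one-hot token to height `1/2`; the factor `2` restores exact indicators.
  Wv := ofParts (tokRow (Pi.single Token.bos 2)) (tokRow fun v => if v.IsInput then 0 else 2)
    (tokRow fun v => if v.IsInput then 2 else 0) 0 0 0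
  ffProj := 0
  W1 := 0
  W2 := 0

/-- The second layer looks up the symbol to be read, and applies the transition function. -/
noncomputable def stepLayer (M : DFA α (Fin r)) : BlockLayer (RegCoord α r) (Fin r × α) where
  attnProj := ofParts (ofParts 1 0 0 0 0 0) (ofParts 0 1 0 0 0 0) 0
    (fun v => tokRow (Pi.single v 1)) 0 0
  -- The query uses the `$`-frequency twice and then the non-input frequency: the direction `(1, 1,
  -- s)`.
  Wq := ofParts (ofParts 1 0 0 0 0 0) (ofParts 1 0 0 0 0 0) (ofParts 0 1 0 0 0 0)
    (fun _ => tokRow fun _ => 4) 0 0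
  -- The first three key coordinates contain everything that enters the layer-norm, so their vector
  -- has constant length `1/2` before truncation. The token coordinates penalize non-input
  -- positions: `-1` here against `4` in the query.
  Wk := ofParts (ofParts 1 0 0 0 0 0) (ofParts 0 1 0 0 0 0) (tokRow fun _ => 1)
    (fun v => tokRow (Pi.single v (if v.IsInput then 0 else -1))) 0 0
  Wv := ofParts 0 0 0 0 (fun a => tokRow (Pi.single (Token.input a) 4)) 0
  ffProj := ofParts 0 0 0 (fun v => tokRow (Pi.single v 1))
    (fun a => ofParts 0 0 0 0 (Pi.single a 1) 0) 0
  -- Symbol coordinates are at most `2` times the token coordinate, so `-3` closes every gate of a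
  -- wrong state.
  W1 g := ofParts 0 0 0 (fun v => if v = Token.aux g.1 then 0 else -3) (Pi.single g.2 1) 0
  W2 := ofParts 0 0 0 0 0 fun q g => if M.step g.1 g.2 = q then 64 else 0

/-- The output map.  The token of a state is preferred to the accept token unless the whole input
has been read. -/
noncomputable def outRow (M : DFA α (Fin r)) : Token α r → RegCoord α r → ℚ
  -- On a run with `s ≥ 1` states the frequencies contribute about `(2(n - s) - 1)/(n + s)`, whose
  -- odd numerator rules out a tie. The weight `32` forces the start state in the first decoding
  -- step.
  | Token.aux q => ofParts (-1) (-2) 2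
      (fun v => if q = M.start ∧ (v.IsInput ∨ v = Token.bos ∧ M.start ∉ M.accept) then 32 else 0)
      0 (Pi.single q 1)
  | Token.accept => ofParts 0 0 0
      (fun v => if v = Token.bos ∧ M.start ∈ M.accept then 32 else 0)
      0 (fun q => if q ∈ M.accept then 1 else 0)
  | _ => 0

/-- The transformer that recognizes the language of the automaton `M`. -/
noncomputable def recognizer {k : ℕ} (pe : ℕ → Fin k → ℝ) (M : DFA α (Fin r)) :
    Transformer (Token α r) where
  m := blockDim k (RegCoord α r)
  h := 1
  dh := blockDim k (RegCoord α r)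
  w := Fintype.card (Fin r × α)
  m_pos := Nat.add_pos_right _ (Fintype.card_pos_iff.2 ⟨(bosFreq, 0)⟩)
  m_eq := (one_mul _).symm
  emb v := liftRow k (tokRow (Pi.single v 1))
  pos i t := if ht : (t : ℕ) < k then pe i ⟨t, ht⟩ else 0
  layers := [(countLayer α r).toLayer k, (stepLayer M).toLayer k]
  out v := liftRow k (outRow M v)

theorem sum_oneHot (u : Token α r) (g : ℝ) (f : Token α r → ℝ → ℝ) (hf : ∀ v, f v 0 = 0) :
    ∑ v, f v (oneHot u g v) = f u g := by
  rw [Fintype.sum_eq_single u, oneHot_self]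
  intro v hv
  simp [oneHot, hv, hf]

theorem rowEval_tokRow (w : Token α r → ℚ) (a b c : ℝ) (u : Token α r) (g : ℝ) (s : α → ℝ)
    (z : Fin r → ℝ) :
    rowEval p (tokRow w) (ofParts a b c (oneHot u g) s z) = trunc p (trunc p (w u) * g) := by
  rw [tokRow, rowEval_ofParts, sum_oneHot u g fun v x => trunc p (trunc p (w v) * x)]
  · simp
  · simp

theorem rowEval_bosRow (hp : 7 ≤ p / 2 - 1) (a b c : ℝ) (t : Token α r → ℝ) (s : α → ℝ)
    (z : Fin r → ℝ) :
    rowEval p (ofParts 1 0 0 0 0 0) (ofParts a b c t s z) = trunc p a := by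
  rw [rowEval_ofParts]
  simp [trunc_one hp]

theorem rowEval_otherRow (hp : 7 ≤ p / 2 - 1) (a b c : ℝ) (t : Token α r → ℝ) (s : α → ℝ)
    (z : Fin r → ℝ) :
    rowEval p (ofParts 0 1 0 0 0 0) (ofParts a b c t s z) = trunc p b := by
  rw [rowEval_ofParts]
  simp [trunc_one hp]

theorem rowEval_single_tok (hp : 7 ≤ p / 2 - 1) (a b c : ℝ) (t : Token α r → ℝ) (s : α → ℝ)
    (z : Fin r → ℝ) (v : Token α r) :
    rowEval p (tokRow (Pi.single v 1)) (ofParts a b c t s z) = trunc p (t v) := by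
  rw [tokRow, rowEval_ofParts, Fintype.sum_eq_single v]
  · simp [trunc_one hp]
  · intro v' hv
    simp [hv]

theorem rowEval_single_sym (hp : 7 ≤ p / 2 - 1) (a b c : ℝ) (t : Token α r → ℝ) (s : α → ℝ)
    (z : Fin r → ℝ) (x : α) :
    rowEval p (ofParts 0 0 0 0 (Pi.single x 1) 0) (ofParts a b c t s z) = trunc p (s x) := by
  rw [rowEval_ofParts, Fintype.sum_eq_single x (f := fun x' => trunc p (trunc p _ * _))]
  · simp [trunc_one hp]
  · intro v' hv
    simp [hv]

/-! ### The first layer -/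

theorem countLayer_norm (hp : 7 ≤ p / 2 - 1) (u : Token α r) :
    projBlockNorm p (countLayer α r).attnProj (ofParts 0 0 0 (oneHot u 1) 0 0) =
      ofParts 0 0 0 (oneHot u (1 / 2)) 0 0 := by
  have h1 : (fun b => rowEval p ((countLayer α r).attnProj b) (ofParts 0 0 0 (oneHot u 1) 0 0)) =
      ofParts 0 0 0 (oneHot u 1) 0 0 := by
    funext b
    cases b with
    | tok v =>
      simp only [countLayer, ofParts]
      rw [rowEval_single_tok hp]
      by_cases hv : v = u
      · subst hv; simp [oneHot, trunc_one hp]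
      · simp [oneHot, hv]
    | _ => simp [countLayer, ofParts]
  have h4 : trunc p (4 : ℝ) = 4 := trunc_ofNat hp 4 (by norm_num)
  have hs : √(4 : ℝ) = 2 := by
    rw [show (4 : ℝ) = 2 ^ 2 by norm_num, Real.sqrt_sq (by norm_num)]
  have h2 : trunc p (2 : ℝ) = 2 := trunc_ofNat hp 2 (by norm_num)
  have hh : trunc p (1 / 2 : ℝ) = 1 / 2 :=
    trunc_of_mem (by simpa using one_div_pow_mem_floats hp (a := 1) (by norm_num))
  rw [projBlockNorm, h1, blockNorm_ofParts (ρ := 2)]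
  · rw [map_oneHot u 1 (fun x => trunc p (x / 2)) (by simp), hh]
    simp
    congr 1
  · rw [sum_oneHot u 1 (fun _ x => trunc p (x * x)) (by simp)]
    simp [trunc_one hp, h4, hs, h2]

/-- The hidden states after the first layer. -/
noncomputable def counted (p : ℕ) (tk : ℕ → Token α r) (s : α → ℝ) (z : Fin r → ℝ) (i : ℕ) :
    RegCoord α r → ℝ :=
  ofParts (freq p (· = Token.bos) tk i) (freq p (fun v => ¬ v.IsInput) tk i)
    (freq p Token.IsInput tk i) (oneHot (tk i) 1) s z

/-- Zero queries make all logits tie, so saturated attention is uniform. -/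
theorem countLayer_attended {k : ℕ} (H : ℕ → Fin (blockDim k (RegCoord α r)) → ℝ) (a : Fin 1)
    (i : ℕ) : ((countLayer α r).toLayer k).attended p H a i = Finset.range i := by
  have h0 : ∀ x y, ((countLayer α r).toLayer k).score p a x y = 0 := by
    intro x y
    rw [BlockLayer.score_toLayer]
    have : ∀ x y, (countLayer α r).dot p x y = 0 := by
      intro x y
      simp [BlockLayer.dot, countLayer]
    simp [this]
  rw [TransformerLayer.attended, Finset.filter_true_of_mem]
  intro j _ j' _
  rw [h0, h0]

theorem countLayer_apply {k : ℕ} (hp : 7 ≤ p / 2 - 1)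
    (H : ℕ → Fin (blockDim k (RegCoord α r)) → ℝ) (tk : ℕ → Token α r) (i : ℕ)
    (hH : ∀ j ≤ i, (fun b => H j (coord k b)) = ofParts 0 0 0 (oneHot (tk j) 1) 0 0) :
    (fun b => ((countLayer α r).toLayer k).apply p H i (coord k b)) = counted p tk 0 0 i := by
  have h2 : trunc p (2 : ℝ) = 2 := trunc_ofNat hp 2 (by norm_num)
  have hhead : ∀ b, ((countLayer α r).toLayer k).head p H 0 i (coord k b) =
      ofParts (freq p (· = Token.bos) tk i) (freq p (fun v => ¬ v.IsInput) tk i)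
        (freq p Token.IsInput tk i) 0 0 0 b := by
    intro b
    rw [BlockLayer.head_toLayer, countLayer_attended, Finset.card_range]
    have hn : ∀ j ∈ Finset.range i, projBlockNorm p (countLayer α r).attnProj
        (fun b => H j (coord k b)) = ofParts 0 0 0 (oneHot (tk j) (1 / 2)) 0 0 := by
      intro j hj
      rw [hH j (Finset.mem_range.1 hj).le, countLayer_norm hp]
    rw [Finset.sum_congr rfl fun j hj => by rw [hn j hj], ← weight]
    cases b with
    | bosFreq =>
      simp only [countLayer, ofParts, rowEval_tokRow]
      rw [← freq_eq]
      congr 1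
      refine Finset.sum_congr rfl fun j _ => ?_
      by_cases h : tk j = Token.bos
      · simp [h, h2, trunc_one hp]
      · simp [h]
    | otherFreq =>
      simp only [countLayer, ofParts, rowEval_tokRow]
      rw [← freq_eq]
      congr 1
      refine Finset.sum_congr rfl fun j _ => ?_
      by_cases h : (tk j).IsInput
      · simp [h]
      · simp [h, h2, trunc_one hp]
    | inputFreq =>
      simp only [countLayer, ofParts, rowEval_tokRow]
      rw [← freq_eq]
      congr 1
      refine Finset.sum_congr rfl fun j _ => ?_
      by_cases h : (tk j).IsInput
      · simp [h, h2, trunc_one hp]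
      · simp [h]
    | _ => simp [countLayer, ofParts]
  funext b
  have hff : ∀ x, ((countLayer α r).toLayer k).feedForward p x (coord k b) =
      trunc p (x (coord k b)) := by
    intro x
    rw [BlockLayer.feedForward_toLayer]
    simp [countLayer]
  have hb : H i (coord k b) = ofParts 0 0 0 (oneHot (tk i) 1) 0 0 b := congrFun (hH i le_rfl) b
  rw [TransformerLayer.apply, hff, BlockLayer.attnOut_toLayer _ hp, trunc_trunc, hhead, hb]
  cases b with
  | tok v =>
    by_cases hv : v = tk i
    · subst hv; simp [ofParts, counted, oneHot, trunc_one hp]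
    · simp [ofParts, counted, oneHot, hv]
  | _ => simp [ofParts, counted, freq]

/-! ### The second layer -/

/-- The norm used in the attention sublayer of the second layer. -/
noncomputable def attnScale (p : ℕ) (a b : ℝ) : ℝ :=
  trunc p √(trunc p (4 * (trunc p (a * a) + trunc p (b * b) + 1)))

/-- The norm used in the feedforward sublayer of the second layer. -/
noncomputable def ffScale (p : ℕ) (y : α → ℝ) : ℝ :=
  trunc p √(trunc p (4 * (1 + ∑ x, trunc p (y x * y x))))

theorem stepLayer_attnNorm (hp : 7 ≤ p / 2 - 1) (M : DFA α (Fin r)) {a b : ℝ} (c : ℝ)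
    (ha : a ∈ floats p) (hb : b ∈ floats p) (u : Token α r) (s : α → ℝ) (z : Fin r → ℝ) :
    projBlockNorm p (stepLayer M).attnProj (ofParts a b c (oneHot u 1) s z) =
      ofParts (trunc p (a / attnScale p a b)) (trunc p (b / attnScale p a b)) 0
        (oneHot u (trunc p (1 / attnScale p a b))) 0 0 := by
  have h1 : (fun d => rowEval p ((stepLayer M).attnProj d) (ofParts a b c (oneHot u 1) s z)) =
      ofParts a b 0 (oneHot u 1) 0 0 := by
    funext d
    cases d with
    | bosFreq => simp only [stepLayer, ofParts, rowEval_bosRow hp, trunc_of_mem ha]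
    | otherFreq => simp only [stepLayer, ofParts, rowEval_otherRow hp, trunc_of_mem hb]
    | tok v =>
      simp only [stepLayer, ofParts, rowEval_single_tok hp]
      by_cases hv : v = u
      · subst hv; simp [oneHot, trunc_one hp]
      · simp [oneHot, hv]
    | _ => simp [stepLayer, ofParts]
  rw [projBlockNorm, h1, blockNorm_ofParts (ρ := attnScale p a b)]
  · rw [map_oneHot u 1 (fun x => trunc p (x / _)) (by simp)]
    simp
    congr 1
  · rw [sum_oneHot u 1 (fun _ x => trunc p (x * x)) (by simp)]
    simp [trunc_one hp, attnScale]

theorem stepLayer_ffNorm (hp : 7 ≤ p / 2 - 1) (M : DFA α (Fin r)) (a b c : ℝ) (u : Token α r)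
    {y : α → ℝ} (hy : ∀ x, y x ∈ floats p) (z : Fin r → ℝ) :
    projBlockNorm p (stepLayer M).ffProj (ofParts a b c (oneHot u 1) y z) =
      ofParts 0 0 0 (oneHot u (trunc p (1 / ffScale p y)))
        (fun x => trunc p (y x / ffScale p y)) 0 := by
  have h1 : (fun d => rowEval p ((stepLayer M).ffProj d) (ofParts a b c (oneHot u 1) y z)) =
      ofParts 0 0 0 (oneHot u 1) y 0 := by
    funext d
    cases d with
    | tok v =>
      simp only [stepLayer, ofParts, rowEval_single_tok hp]
      by_cases hv : v = u
      · subst hv; simp [oneHot, trunc_one hp]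
      · simp [oneHot, hv]
    | sym x => simp only [stepLayer, ofParts, rowEval_single_sym hp, trunc_of_mem (hy x)]
    | _ => simp [stepLayer, ofParts]
  rw [projBlockNorm, h1, blockNorm_ofParts (ρ := ffScale p y)]
  · rw [map_oneHot u 1 (fun x => trunc p (x / _)) (by simp)]
    simp
    congr 1
  · rw [sum_oneHot u 1 (fun _ x => trunc p (x * x)) (by simp)]
    simp [trunc_one hp, ffScale]

/-- The query has equal entries at all token coordinates and the key is supported at its own token
`u'`, so the token coordinates leave one term: the penalty. -/
theorem stepLayer_dot (hp : 7 ≤ p / 2 - 1) (M : DFA α (Fin r)) {a b a' b' : ℝ} (c c' : ℝ)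
    (ha : a ∈ floats p) (hb : b ∈ floats p) (ha' : a' ∈ floats p) (hb' : b' ∈ floats p)
    (u u' : Token α r) (s s' : α → ℝ) (z z' : Fin r → ℝ) :
    (stepLayer M).dot p (ofParts a b c (oneHot u 1) s z) (ofParts a' b' c' (oneHot u' 1) s' z') =
      trunc p (trunc p (a / attnScale p a b) * trunc p (a' / attnScale p a' b')) +
      trunc p (trunc p (a / attnScale p a b) * trunc p (b' / attnScale p a' b')) +
      trunc p (trunc p (b / attnScale p a b) * trunc p (1 / attnScale p a' b')) -
      if u'.IsInput then 0 else
        trunc p (trunc p (4 * trunc p (1 / attnScale p a b)) *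
          trunc p (1 / attnScale p a' b')) := by
  have h4 : trunc p (4 : ℝ) = 4 := trunc_ofNat hp 4 (by norm_num)
  rw [BlockLayer.dot, stepLayer_attnNorm hp M c ha hb, stepLayer_attnNorm hp M c' ha' hb', sum_eq]
  simp only [stepLayer, ofParts, rowEval_bosRow hp, rowEval_otherRow hp, rowEval_tokRow,
    trunc_trunc, Rat.cast_one, trunc_one hp, one_mul]
  rw [Fintype.sum_eq_single u']
  · by_cases h : u'.IsInput
    · simp [h]
    · simp [h, h4, trunc_one hp, sub_eq_add_neg]
  · intro v hv
    simp [hv.symm]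

theorem stepLayer_value (hp : 7 ≤ p / 2 - 1) (M : DFA α (Fin r)) {a b : ℝ} (c : ℝ)
    (ha : a ∈ floats p) (hb : b ∈ floats p) (u : Token α r) (s : α → ℝ) (z : Fin r → ℝ)
    (x : α) :
    rowEval p ((stepLayer M).Wv (sym x))
        (projBlockNorm p (stepLayer M).attnProj (ofParts a b c (oneHot u 1) s z)) =
      if u = Token.input x then trunc p (4 * trunc p (1 / attnScale p a b)) else 0 := by
  have h4 : trunc p (4 : ℝ) = 4 := trunc_ofNat hp 4 (by norm_num)
  rw [stepLayer_attnNorm hp M c ha hb]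
  simp only [stepLayer, ofParts, rowEval_tokRow]
  by_cases h : u = Token.input x
  · simp [h, h4]
  · simp [h]

/-- For a wrong state the preactivation is at most `2/ρ - (3/ρ - 4 * err p)` with `ρ = ffScale p y`:
the error in `1/ρ` is tripled, and the product is truncated once more. Hypothesis `he` makes this
negative. -/
theorem stepLayer_gate (hp : 7 ≤ p / 2 - 1) (M : DFA α (Fin r)) (a b c : ℝ) (u : Token α r)
    {y : α → ℝ} (hy : ∀ x, y x ∈ floats p) (hy0 : ∀ x, 0 ≤ y x) (hy2 : ∀ x, y x ≤ 2)
    (z : Fin r → ℝ) (hs : 2 ≤ ffScale p y) (he : 4 * err p < 1 / ffScale p y)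
    (g : Fin r × α) :
    (stepLayer M).gate p (ofParts a b c (oneHot u 1) y z) g =
      if u = Token.aux g.1 then trunc p (y g.2 / ffScale p y) else 0 := by
  have h3 : trunc p (3 : ℝ) = 3 := trunc_ofNat hp 3 (by norm_num)
  rw [BlockLayer.gate, stepLayer_ffNorm hp M a b c u hy]
  simp only [stepLayer]
  rw [rowEval_ofParts, Fintype.sum_eq_single g.2 (f := fun x' : α => trunc p (trunc p _ * _)),
    sum_oneHot u (trunc p (1 / ffScale p y)) fun v x => trunc p
      (trunc p ((if v = Token.aux g.1 then 0 else -3 : ℚ) : ℝ) * x)]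
  · set ρ := ffScale p y
    have hρ : 0 < ρ := by linarith
    have hnn : 0 ≤ trunc p (y g.2 / ρ) := trunc_nonneg (div_nonneg (hy0 _) hρ.le)
    by_cases h : u = Token.aux g.1
    · simp [h, trunc_one hp, hnn]
    · simp [h, trunc_one hp, h3]
      have h1 : ρ⁻¹ ≤ 1 / 2 := by
        rw [← one_div]; exact one_div_le_one_div_of_le (by norm_num) hs
      have h0 : 0 < ρ⁻¹ := inv_pos.2 hρ
      have e1 : ρ⁻¹ - err p ≤ trunc p ρ⁻¹ := sub_err_le_trunc hp h0.le (by linarith)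
      have e1' : trunc p ρ⁻¹ ≤ ρ⁻¹ := trunc_le h0.le
      have e2 : 3 * trunc p ρ⁻¹ - err p ≤ trunc p (3 * trunc p ρ⁻¹) :=
        sub_err_le_trunc hp (by linarith [trunc_nonneg (p := p) h0.le]) (by linarith)
      have e3 : trunc p (y g.2 / ρ) ≤ y g.2 / ρ := trunc_le (div_nonneg (hy0 _) hρ.le)
      have e4 : y g.2 / ρ ≤ 2 * ρ⁻¹ := by
        rw [div_eq_mul_inv]; exact mul_le_mul_of_nonneg_right (hy2 _) h0.le
      rw [one_div] at he
      exact trunc_le_of_le (zero_mem_floats p) (by linarith)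
  · simp
  · intro x' hx
    simp [hx]

/-- The norm used at position `i` in the attention sublayer of the second layer. -/
noncomputable def scaleAt (p : ℕ) (tk : ℕ → Token α r) (i : ℕ) : ℝ :=
  attnScale p (freq p (· = Token.bos) tk i) (freq p (fun v => ¬ v.IsInput) tk i)

/-- The average of the symbols at the positions in `S`. -/
noncomputable def lookup (p : ℕ) (tk : ℕ → Token α r) (S : Finset ℕ) (x : α) : ℝ :=
  trunc p (∑ j ∈ S, trunc p (trunc p (1 / trunc p (S.card : ℝ)) *
    if tk j = Token.input x then trunc p (4 * trunc p (1 / scaleAt p tk j)) else 0))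

/-- The output of the feedforward sublayer of the second layer. -/
noncomputable def nextState (p : ℕ) (M : DFA α (Fin r)) (u : Token α r) (y : α → ℝ) (q : Fin r) :
    ℝ :=
  trunc p (∑ g : Fin r × α, trunc p (trunc p ((if M.step g.1 g.2 = q then 64 else 0 : ℚ) : ℝ) *
    if u = Token.aux g.1 then trunc p (y g.2 / ffScale p y) else 0))

/-- Only bounds on the retrieved vector `y` are assumed, so this also covers the first decoding
step, where the attended set is not determined. -/
theorem stepLayer_apply {k : ℕ} (hp : 7 ≤ p / 2 - 1) (M : DFA α (Fin r))
    (H : ℕ → Fin (blockDim k (RegCoord α r)) → ℝ) (tk : ℕ → Token α r) (i : ℕ)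
    (hH : ∀ j ≤ i, (fun b => H j (coord k b)) = counted p tk 0 0 j) {y : α → ℝ}
    (hy : lookup p tk (((stepLayer M).toLayer k).attended p H 0 i) = y)
    (hy0 : ∀ x, 0 ≤ y x) (hy2 : ∀ x, y x ≤ 2) (hs : 2 ≤ ffScale p y)
    (he : 4 * err p < 1 / ffScale p y) :
    (fun b => ((stepLayer M).toLayer k).apply p H i (coord k b)) =
      counted p tk y (nextState p M (tk i) y) i := by
  have hym : ∀ x, y x ∈ floats p := by
    intro x
    rw [← hy]
    exact trunc_mem _ _
  have hhead : ∀ b, ((stepLayer M).toLayer k).head p H 0 i (coord k b) =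
      ofParts 0 0 0 0 y 0 b := by
    intro b
    rw [BlockLayer.head_toLayer]
    have hle : ∀ j ∈ ((stepLayer M).toLayer k).attended p H 0 i, j ≤ i := by
      intro j hj
      exact (Finset.mem_range.1 (Finset.mem_filter.1 hj).1).le
    rw [Finset.sum_congr rfl fun j hj => by rw [hH j (hle j hj)]]
    cases b with
    | sym x =>
      simp only [counted, stepLayer_value hp M _ (freq_mem _ _ _) (freq_mem _ _ _)]
      rw [← hy]
      rfl
    | _ => simp [stepLayer, ofParts]
  have hattn : (fun b => ((stepLayer M).toLayer k).attnOut p H i (coord k b)) =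
      counted p tk y 0 i := by
    funext b
    have hb : H i (coord k b) = counted p tk 0 0 i b := congrFun (hH i le_rfl) b
    rw [BlockLayer.attnOut_toLayer _ hp, hhead, hb]
    cases b with
    | tok v =>
      by_cases hv : v = tk i
      · subst hv; simp [ofParts, counted, oneHot, trunc_one hp]
      · simp [ofParts, counted, oneHot, hv]
    | sym x => simp [ofParts, counted, trunc_of_mem (hym x)]
    | _ => simp [ofParts, counted, freq]
  funext b
  have hb : ((stepLayer M).toLayer k).attnOut p H i (coord k b) = counted p tk y 0 i b :=
    congrFun hattn b
  have hg : (stepLayer M).gate p (counted p tk y 0 i) = fun g =>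
      if tk i = Token.aux g.1 then trunc p (y g.2 / ffScale p y) else 0 := by
    funext g
    exact stepLayer_gate hp M _ _ _ _ hym hy0 hy2 _ hs he g
  rw [TransformerLayer.apply, BlockLayer.feedForward_toLayer, hattn, hb, hg]
  cases b with
  | tok v =>
    by_cases hv : v = tk i
    · subst hv; simp [ofParts, counted, oneHot, trunc_one hp, stepLayer]
    · simp [ofParts, counted, oneHot, hv, stepLayer]
  | sym x => simp [ofParts, counted, trunc_of_mem (hym x), stepLayer]
  | res q =>
    simp only [ofParts, counted, stepLayer, Pi.zero_apply, add_zero, trunc_rowEval]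
    rfl
  | _ => simp [ofParts, counted, freq, stepLayer]

end Recognizer

/-! ### Numerical estimates -/

section Estimates

variable {p : ℕ}

/-- The precision `p` suffices for inputs of total length `N`, with constant `K`. -/
structure Precise (p N K : ℕ) : Prop where
  le_bits : 7 ≤ p / 2 - 1
  two_le : 2 ≤ N
  -- The attention margin is of order `N ^ (-4)` and the accumulated error of order `N * err p`,
  -- whence the exponent `5`.
  err_lt : (K : ℝ) * N ^ 5 * err p < 1

theorem weight_eq {i : ℕ} (hi : i < 2 ^ (p / 2 - 1)) : weight p i = trunc p (1 / i) := by
  rw [weight, trunc_of_mem (natCast_mem_floats hi)]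

theorem weight_nonneg (p i : ℕ) : 0 ≤ weight p i :=
  trunc_nonneg (div_nonneg zero_le_one (trunc_nonneg (Nat.cast_nonneg i)))

theorem weight_le {i : ℕ} (hi : i < 2 ^ (p / 2 - 1)) : weight p i ≤ 1 / i := by
  rw [weight_eq hi]
  exact trunc_le (by positivity)

theorem one_div_natCast_le_one (i : ℕ) : (1 : ℝ) / i ≤ 1 := by
  rcases Nat.eq_zero_or_pos i with rfl | hi
  · simp
  · exact (div_le_one (by positivity)).2 (by exact_mod_cast hi)

theorem le_weight (hp : 7 ≤ p / 2 - 1) {i : ℕ} (hi : i < 2 ^ (p / 2 - 1)) :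
    1 / i - err p ≤ weight p i := by
  rw [weight_eq hi]
  exact sub_err_le_trunc hp (by positivity) (by linarith [one_div_natCast_le_one i])

theorem attnScale_mem (hp : 7 ≤ p / 2 - 1) {a b : ℝ} (ha : 0 ≤ a) (ha1 : a ≤ 1) (hb : 0 ≤ b)
    (hb1 : b ≤ 1) : 2 ≤ attnScale p a b ∧ attnScale p a b ≤ 4 := by
  have h1 : trunc p (a * a) ≤ 1 := trunc_le_of_le (one_mem_floats hp) (by nlinarith)
  have h2 : trunc p (b * b) ≤ 1 := trunc_le_of_le (one_mem_floats hp) (by nlinarith)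
  have h3 : 0 ≤ trunc p (a * a) := trunc_nonneg (by positivity)
  have h4 : 0 ≤ trunc p (b * b) := trunc_nonneg (by positivity)
  constructor
  · refine le_trunc (ofNat_mem_floats hp 2 (by norm_num)) (Real.le_sqrt_of_sq_le ?_)
    exact le_trans (by norm_num) (le_trunc (f := 4) (ofNat_mem_floats hp 4 (by norm_num))
      (by linarith))
  · refine trunc_le_of_le (ofNat_mem_floats hp 4 (by norm_num)) ?_
    rw [Real.sqrt_le_left (by norm_num)]
    exact (trunc_le (by linarith)).trans (by linarith)

theorem trunc_one_div_mem {ρ : ℝ} (hp : 7 ≤ p / 2 - 1) (h2 : 2 ≤ ρ) (h4 : ρ ≤ 4) :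
    1 / 4 ≤ trunc p (1 / ρ) ∧ trunc p (1 / ρ) ≤ 1 / 2 := by
  have m4 : (1 / 4 : ℝ) ∈ floats p := by
    have := one_div_pow_mem_floats hp (a := 2) (by norm_num)
    norm_num at this ⊢; exact this
  have m2 : (1 / 2 : ℝ) ∈ floats p := by
    have := one_div_pow_mem_floats hp (a := 1) (by norm_num)
    norm_num at this ⊢; exact this
  exact ⟨le_trunc m4 (one_div_le_one_div_of_le (by linarith) h4),
    trunc_le_of_le m2 (one_div_le_one_div_of_le (by norm_num) h2)⟩

/-- The norm at the input position `j` is close to `2 √(j² + 2) / j`. -/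
theorem attnScale_weight (hp : 7 ≤ p / 2 - 1) {j : ℕ} (hj : 1 ≤ j) (hj' : j < 2 ^ (p / 2 - 1)) :
    2 * √((j : ℝ) ^ 2 + 2) * (1 / j) - 8 * err p ≤ attnScale p (weight p j) (weight p j) ∧
      attnScale p (weight p j) (weight p j) ≤ 2 * √((j : ℝ) ^ 2 + 2) * (1 / j) ∧
      2 ≤ 2 * √((j : ℝ) ^ 2 + 2) * (1 / j) := by
  set δ := err p with hδ
  have hδ0 : 0 < δ := err_pos p
  set w := weight p j with hw
  have hw0 : 0 ≤ w := weight_nonneg p j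
  have hw1 : w ≤ 1 / j := weight_le hj'
  have hw2 : 1 / j - δ ≤ w := le_weight hp hj'
  have hj1 : (1 : ℝ) ≤ j := by exact_mod_cast hj
  have hi1 : (1 : ℝ) / j ≤ 1 := one_div_natCast_le_one j
  have hi0 : (0 : ℝ) < 1 / j := by positivity
  set T : ℝ := 4 * (2 * (1 / j * (1 / j)) + 1) with hT
  have hTR : √T = 2 * √((j : ℝ) ^ 2 + 2) * (1 / j) := by
    have : T = (2 * √((j : ℝ) ^ 2 + 2) * (1 / j)) ^ 2 := by
      rw [mul_pow, mul_pow, Real.sq_sqrt (by positivity), hT]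
      field_simp
      ring
    rw [this, Real.sqrt_sq (by positivity)]
  rw [← hTR]
  clear_value T w δ
  set v : ℝ := 1 / j with hv
  clear_value v
  have hww : v * v - 2 * δ ≤ w * w := by nlinarith
  have hww' : w * w ≤ v * v := mul_self_le_mul_self hw0 hw1
  have hvv : v * v ≤ 1 := by nlinarith
  have hvv0 : 0 < v * v := mul_pos hi0 hi0
  have hww0 : 0 ≤ w * w := mul_self_nonneg w
  have t1 : v * v - 3 * δ ≤ trunc p (w * w) := by
    linarith [sub_err_le_trunc hp hww0 (by linarith)]
  have t2 : trunc p (w * w) ≤ v * v := (trunc_le hww0).trans hww'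
  have t0 : 0 ≤ trunc p (w * w) := trunc_nonneg hww0
  rw [attnScale]
  set S := 4 * (trunc p (w * w) + trunc p (w * w) + 1) with hS
  have s1 : S - δ ≤ trunc p S := hδ ▸ sub_err_le_trunc hp (by linarith) (by linarith)
  have s2 : trunc p S ≤ S := trunc_le (by linarith)
  have s4 : 4 ≤ trunc p S := le_trunc (ofNat_mem_floats hp 4 (by norm_num)) (by linarith)
  have hR2 : √T ^ 2 = T := Real.sq_sqrt (by linarith)
  have hRge : 2 ≤ √T := Real.le_sqrt_of_sq_le (by linarith)
  have hRle : √T ≤ 4 := (Real.sqrt_le_left (by norm_num)).2 (by linarith)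
  have hQ2 : √(trunc p S) ^ 2 = trunc p S := Real.sq_sqrt (by linarith)
  have hQge : 2 ≤ √(trunc p S) := Real.le_sqrt_of_sq_le (by linarith)
  have hQR : √(trunc p S) ≤ √T := Real.sqrt_le_sqrt (by linarith)
  have hQR' : √T - 7 * δ ≤ √(trunc p S) := by
    -- Each of the two squares is off by at most `3δ`; the factor `4` and the truncation of `S` give
    -- `4 * 6 + 1 = 25`. Dividing by the sum of the roots, at least `4`, leaves less than `7δ`.
    have h1 : √T ^ 2 - √(trunc p S) ^ 2 ≤ 25 * δ := by rw [hR2, hQ2]; linarith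
    have h2 : (√T - √(trunc p S)) * 4 ≤ (√T - √(trunc p S)) * (√T + √(trunc p S)) :=
      mul_le_mul_of_nonneg_left (by linarith) (by linarith)
    linarith
  have r0 : √(trunc p S) - δ ≤ trunc p √(trunc p S) :=
    hδ ▸ sub_err_le_trunc hp (by linarith) (by linarith)
  exact ⟨by linarith, (trunc_le (by linarith)).trans hQR, hRge⟩

/-- The keys at the input positions are close to `(1, 1, j) / (2 √(j² + 2))`. -/
theorem key_estimate (hp : 7 ≤ p / 2 - 1) {j : ℕ} (hj : 1 ≤ j) (hj' : j < 2 ^ (p / 2 - 1)) :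
    |trunc p (weight p j / attnScale p (weight p j) (weight p j)) - 1 / (2 * √((j : ℝ) ^ 2 + 2))|
        ≤ 2 * err p ∧
      |trunc p (1 / attnScale p (weight p j) (weight p j)) - j / (2 * √((j : ℝ) ^ 2 + 2))|
        ≤ 2 * err p := by
  obtain ⟨r1, r2, hRge⟩ := attnScale_weight hp hj hj'
  set δ := err p with hδ
  have hδ0 : 0 < δ := err_pos p
  set w := weight p j with hw
  have hw0 : 0 ≤ w := weight_nonneg p j
  have hw1 : w ≤ 1 / j := weight_le hj'
  have hw2 : 1 / j - δ ≤ w := le_weight hp hj'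
  have hj1 : (1 : ℝ) ≤ j := by exact_mod_cast hj
  have hi1 : (1 : ℝ) / j ≤ 1 := one_div_natCast_le_one j
  have hi0 : (0 : ℝ) < 1 / j := by positivity
  have hρ2 := (attnScale_mem hp hw0 (hw1.trans hi1) hw0 (hw1.trans hi1)).1
  set ρ := attnScale p w w with hρ
  set R := 2 * √((j : ℝ) ^ 2 + 2) * (1 / j) with hR
  have e1 : 1 / (2 * √((j : ℝ) ^ 2 + 2)) = 1 / j * (1 / R) := by
    rw [hR]
    field_simp
  have e2 : j / (2 * √((j : ℝ) ^ 2 + 2)) = 1 / R := by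
    rw [hR]
    field_simp
  rw [e1, e2]
  clear_value ρ R w δ
  set v : ℝ := 1 / j with hv
  clear_value v
  have hρ0 : 0 < ρ := by linarith
  have hR0 : 0 < R := by linarith
  have i1 : 1 / R ≤ 1 / ρ := one_div_le_one_div_of_le hρ0 r2
  -- Both norms are at least `2`, so inversion divides the error `8δ` by at least `4`.
  have i2 : 1 / ρ ≤ 1 / R + 2 * δ := by
    have h1 : 1 / ρ - 1 / R = (R - ρ) / (ρ * R) := by
      field_simp
    have h2 : (R - ρ) / (ρ * R) ≤ 2 * δ := by
      rw [div_le_iff₀ (by positivity)]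
      have h3 : 2 * 2 ≤ ρ * R := mul_le_mul hρ2 hRge (by norm_num) hρ0.le
      have h4 : 2 * δ * (2 * 2) ≤ 2 * δ * (ρ * R) := mul_le_mul_of_nonneg_left h3 (by linarith)
      linarith
    linarith
  have i3 : 1 / R ≤ 1 / 2 := one_div_le_one_div_of_le (by norm_num) hRge
  have i4 : 1 / ρ ≤ 1 / 2 := one_div_le_one_div_of_le (by norm_num) hρ2
  have i0 : 0 < 1 / R := by positivity
  rw [abs_le, abs_le, div_eq_mul_one_div w]
  set R' := 1 / R
  set ρ' := 1 / ρ
  clear_value R' ρ'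
  have hρ'0 : 0 ≤ ρ' := by linarith
  have p2 : w * ρ' ≤ v * R' + 2 * δ := by
    calc w * ρ' ≤ v * (R' + 2 * δ) := mul_le_mul hw1 i2 hρ'0 hi0.le
      _ ≤ _ := by nlinarith
  have p3 : v * R' - δ ≤ w * ρ' := by
    calc v * R' - δ ≤ w * R' := by nlinarith
      _ ≤ _ := mul_le_mul_of_nonneg_left i1 hw0
  have p0 : 0 ≤ w * ρ' := mul_nonneg hw0 hρ'0
  have p6 : w * ρ' ≤ 1 * (1 / 2) := mul_le_mul (hw1.trans hi1) i4 hρ'0 zero_le_one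
  have p4 : trunc p (w * ρ') ≤ w * ρ' := trunc_le p0
  have p5 : w * ρ' - δ ≤ trunc p (w * ρ') := hδ ▸ sub_err_le_trunc hp p0 (by linarith)
  have q4 : trunc p ρ' ≤ ρ' := trunc_le hρ'0
  have q5 : ρ' - δ ≤ trunc p ρ' := hδ ▸ sub_err_le_trunc hp hρ'0 (by linarith)
  refine ⟨⟨?_, ?_⟩, ?_, ?_⟩ <;> linarith

/-- The directions `(1, 1, s)` and `(1, 1, j)` differ. -/
theorem direction_gap {s j N : ℕ} (hs : 1 ≤ s) (hj : 1 ≤ j) (hsN : 2 * s ≤ N) (hjN : 2 * j ≤ N)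
    (hsj : j ≠ s) :
    (2 + s * j) / √((j : ℝ) ^ 2 + 2) + 1 / N ^ 3 ≤ (2 + s * s) / √((s : ℝ) ^ 2 + 2) := by
  have hs1 : (1 : ℝ) ≤ s := by exact_mod_cast hs
  have hj1 : (1 : ℝ) ≤ j := by exact_mod_cast hj
  have hsN' : 2 * (s : ℝ) ≤ N := by exact_mod_cast hsN
  have hjN' : 2 * (j : ℝ) ≤ N := by exact_mod_cast hjN
  have hN : (0 : ℝ) < N := by linarith
  have hd : (1 : ℝ) ≤ ((s : ℝ) - j) ^ 2 := by
    have h : (1 : ℤ) ≤ ((s : ℤ) - j) ^ 2 := by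
      have : (s : ℤ) - j ≠ 0 := by omega
      have := pow_pos (abs_pos.2 this) 2
      rw [sq_abs] at this
      omega
    exact_mod_cast h
  set X := √((s : ℝ) ^ 2 + 2) with hX
  set Y := √((j : ℝ) ^ 2 + 2) with hY
  have hX2 : X ^ 2 = (s : ℝ) ^ 2 + 2 := Real.sq_sqrt (by positivity)
  have hY2 : Y ^ 2 = (j : ℝ) ^ 2 + 2 := Real.sq_sqrt (by positivity)
  have hX0 : 0 < X := Real.sqrt_pos.2 (by positivity)
  have hY0 : 0 < Y := Real.sqrt_pos.2 (by positivity)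
  have hXN : X ≤ N := by
    refine (Real.sqrt_le_left hN.le).2 ?_
    nlinarith
  have hYN : Y ≤ N := by
    refine (Real.sqrt_le_left hN.le).2 ?_
    nlinarith
  have e1 : (2 + (s : ℝ) * s) / X = X := by
    rw [div_eq_iff hX0.ne']; nlinarith
  rw [e1]
  set D := 2 + (s : ℝ) * j with hD
  have hD0 : 0 < D := by positivity
  -- Lagrange's identity for `(1, 1, s)` and `(1, 1, j)`. As `s ≠ j` are integers, the right side is
  -- at least `2`; dividing by `X * Y + D ≤ 2 * N ^ 2` and then by `Y ≤ N` gives the gap `1 / N ^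
  -- 3`.
  have hprod : (X * Y) ^ 2 - D ^ 2 = 2 * ((s : ℝ) - j) ^ 2 := by
    rw [mul_pow, hX2, hY2]; ring
  have hXY : X * Y ≤ N ^ 2 := by nlinarith
  have hDXY : D ≤ X * Y := by
    have : D ^ 2 ≤ (X * Y) ^ 2 := by linarith
    exact (pow_le_pow_iff_left₀ hD0.le (by positivity) (by norm_num)).1 this
  have hgap : 1 ≤ (X * Y - D) * N ^ 2 := by
    have h1 : 2 ≤ (X * Y - D) * (X * Y + D) := by nlinarith
    have h2 : (X * Y - D) * (X * Y + D) ≤ (X * Y - D) * (2 * N ^ 2) :=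
      mul_le_mul_of_nonneg_left (by linarith) (by linarith)
    linarith
  have h3 : 1 / (N : ℝ) ^ 3 ≤ (X * Y - D) / Y := by
    rw [div_le_div_iff₀ (by positivity) hY0]
    calc 1 * Y ≤ 1 * N := by linarith
      _ ≤ ((X * Y - D) * N ^ 2) * N := mul_le_mul_of_nonneg_right hgap hN.le
      _ = _ := by ring
  have h4 : (X * Y - D) / Y = X - D / Y := by
    field_simp
  linarith

/-- Truncated products of approximations. -/
theorem abs_trunc_mul_sub_le (hp : 7 ≤ p / 2 - 1) {x y x' y' ε ε' : ℝ} (hx : 0 ≤ x) (hx1 : x ≤ 1)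
    (hy : 0 ≤ y) (hy1 : y ≤ 1) (hy'0 : 0 ≤ y') (hy'1 : y' ≤ 1) (hxe : |x - x'| ≤ ε)
    (hye : |y - y'| ≤ ε') : |trunc p (x * y) - x' * y'| ≤ ε + ε' + err p := by
  have h1 : |trunc p (x * y) - x * y| ≤ err p :=
    abs_trunc_sub_le hp (by rw [abs_of_nonneg (by positivity)]; nlinarith)
  have h2 : |x * y - x' * y'| ≤ ε + ε' := by
    have : x * y - x' * y' = (x - x') * y' + x * (y - y') := by ring
    rw [this]
    refine (abs_add_le _ _).trans ?_
    rw [abs_mul, abs_mul, abs_of_nonneg hy'0, abs_of_nonneg hx]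
    have a1 := abs_nonneg (x - x')
    have a2 := abs_nonneg (y - y')
    nlinarith
  have := abs_add_le (trunc p (x * y) - x * y) (x * y - x' * y')
  rw [sub_add_sub_cancel] at this
  linarith

end Estimates

/-! ### Token counts along a run and the position attended to -/

section Recognizer

open Classical RegCoord

variable {α : Type*} {r : ℕ} {p : ℕ}

/-- The tokens `$ x₁ … xₙ g₁ … gₛ` of a run of the recognizer. -/
structure Trace (tk : ℕ → Token α r) (n s : ℕ) : Prop where
  le : s ≤ n
  bos : tk 0 = Token.bos
  input : ∀ j, 1 ≤ j → j ≤ n → ∃ a, tk j = Token.input a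
  aux : ∀ j, n < j → j ≤ n + s → ∃ q, tk j = Token.aux q

theorem countBefore_le (S : Token α r → Prop) (tk : ℕ → Token α r) (i : ℕ) :
    countBefore S tk i ≤ i := by
  simpa [countBefore] using Finset.card_filter_le (Finset.range i) fun j => S (tk j)

namespace Trace

variable {tk : ℕ → Token α r} {n s : ℕ}

theorem isInput_iff (h : Trace tk n s) {j : ℕ} (hj : j ≤ n + s) :
    (tk j).IsInput ↔ 1 ≤ j ∧ j ≤ n := by
  rcases Nat.eq_zero_or_pos j with rfl | h0
  · simp [h.bos, Token.IsInput]
  · rcases le_or_gt j n with h1 | h1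
    · obtain ⟨a, ha⟩ := h.input j h0 h1
      rw [ha]
      simp [Token.IsInput]
      omega
    · obtain ⟨q, hq⟩ := h.aux j h1 hj
      rw [hq]
      simp [Token.IsInput]
      omega

theorem eq_bos_iff (h : Trace tk n s) {j : ℕ} (hj : j ≤ n + s) :
    tk j = Token.bos ↔ j = 0 := by
  rcases Nat.eq_zero_or_pos j with rfl | h0
  · simp [h.bos]
  · rcases le_or_gt j n with h1 | h1
    · obtain ⟨a, ha⟩ := h.input j h0 h1
      rw [ha]
      simp
      omega
    · obtain ⟨q, hq⟩ := h.aux j h1 hj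
      rw [hq]
      simp
      omega

theorem countBefore_bos (h : Trace tk n s) {i : ℕ} (h1 : 1 ≤ i) (hi : i ≤ n + s) :
    countBefore (· = Token.bos) tk i = 1 := by
  rw [countBefore, Finset.card_eq_one]
  refine ⟨0, ?_⟩
  ext j
  simp only [Finset.mem_filter, Finset.mem_range, Finset.mem_singleton]
  constructor
  · rintro ⟨hj, hb⟩
    exact (h.eq_bos_iff (by omega)).1 hb
  · rintro rfl
    exact ⟨h1, h.bos⟩

theorem countBefore_other_of_le (h : Trace tk n s) {i : ℕ} (h1 : 1 ≤ i) (hi : i ≤ n) :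
    countBefore (fun v => ¬ v.IsInput) tk i = 1 := by
  rw [countBefore, Finset.card_eq_one]
  refine ⟨0, ?_⟩
  ext j
  simp only [Finset.mem_filter, Finset.mem_range, Finset.mem_singleton]
  constructor
  · rintro ⟨hj, hb⟩
    rw [h.isInput_iff (by omega)] at hb
    omega
  · rintro rfl
    exact ⟨h1, by rw [h.isInput_iff (by omega)]; omega⟩

theorem countBefore_input (h : Trace tk n s) (h1 : 1 ≤ s) :
    countBefore Token.IsInput tk (n + s) = n := by
  have : ((Finset.range (n + s)).filter fun j => (tk j).IsInput) = Finset.Ico 1 (n + 1) := by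
    ext j
    simp only [Finset.mem_filter, Finset.mem_range, Finset.mem_Ico]
    constructor
    · rintro ⟨hj, hb⟩
      rw [h.isInput_iff (by omega)] at hb
      omega
    · rintro hj
      exact ⟨by omega, by rw [h.isInput_iff (by omega)]; omega⟩
  rw [countBefore, this]
  simp

/-- Strict causality omits position `n + s` itself, so `$` and the first `s - 1` states are counted.
The total is therefore exactly the position of the next letter. -/
theorem countBefore_other (h : Trace tk n s) (h1 : 1 ≤ s) :
    countBefore (fun v => ¬ v.IsInput) tk (n + s) = s := by
  have h2 := h.countBefore_input h1
  have h3 : countBefore Token.IsInput tk (n + s) +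
      countBefore (fun v => ¬ v.IsInput) tk (n + s) = n + s := by
    unfold countBefore
    convert Finset.card_filter_add_card_filter_not (s := Finset.range (n + s))
      (fun j => (tk j).IsInput)
    simp
  omega

end Trace

section Freq

variable (S : Token α r → Prop) (tk : ℕ → Token α r) {i : ℕ}

theorem freq_nonneg : 0 ≤ freq p S tk i :=
  trunc_nonneg (mul_nonneg (Nat.cast_nonneg _) (weight_nonneg p i))

theorem freq_le_one (hi : i < 2 ^ (p / 2 - 1)) : freq p S tk i ≤ 1 := by
  refine (trunc_le (mul_nonneg (Nat.cast_nonneg _) (weight_nonneg p i))).trans ?_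
  have h1 : (countBefore S tk i : ℝ) ≤ i := by exact_mod_cast countBefore_le S tk i
  calc (countBefore S tk i : ℝ) * weight p i ≤ i * (1 / i) :=
        mul_le_mul h1 (weight_le hi) (weight_nonneg p i) (Nat.cast_nonneg i)
    _ ≤ 1 := by rw [mul_one_div]; exact div_self_le_one _

theorem scaleAt_mem (hp : 7 ≤ p / 2 - 1) (hi : i < 2 ^ (p / 2 - 1)) :
    2 ≤ scaleAt p tk i ∧ scaleAt p tk i ≤ 4 :=
  attnScale_mem hp (freq_nonneg _ _) (freq_le_one _ _ hi) (freq_nonneg _ _) (freq_le_one _ _ hi)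

/-- A frequency is close to its exact value. -/
theorem freq_estimate (hp : 7 ≤ p / 2 - 1) (hi : i < 2 ^ (p / 2 - 1)) :
    freq p S tk i ≤ countBefore S tk i * (1 / i) ∧
      countBefore S tk i * (1 / i) - (countBefore S tk i + 1) * err p ≤ freq p S tk i := by
  have h0 : 0 ≤ countBefore S tk i * weight p i :=
    mul_nonneg (Nat.cast_nonneg _) (weight_nonneg p i)
  have hc : (0 : ℝ) ≤ countBefore S tk i := Nat.cast_nonneg _
  have h1 : countBefore S tk i * weight p i ≤ countBefore S tk i * (1 / i) :=
    mul_le_mul_of_nonneg_left (weight_le hi) hc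
  have h2 : countBefore S tk i * (1 / i - err p) ≤ countBefore S tk i * weight p i :=
    mul_le_mul_of_nonneg_left (le_weight hp hi) hc
  have h3 : (countBefore S tk i : ℝ) * (1 / i) ≤ 1 := by
    have h1 : (countBefore S tk i : ℝ) ≤ i := by exact_mod_cast countBefore_le S tk i
    calc (countBefore S tk i : ℝ) * (1 / i) ≤ i * (1 / i) :=
          mul_le_mul_of_nonneg_right h1 (by positivity)
      _ ≤ 1 := by rw [mul_one_div]; exact div_self_le_one _
  refine ⟨(trunc_le h0).trans h1, ?_⟩
  have := sub_err_le_trunc hp h0 (by linarith)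
  rw [freq]
  linarith

end Freq

/-- The coordinates of the queries and keys: the normalized frequency of tokens satisfying `S`. -/
noncomputable def normFreq (p : ℕ) (S : Token α r → Prop) (tk : ℕ → Token α r) (i : ℕ) : ℝ :=
  trunc p (freq p S tk i / scaleAt p tk i)

/-- The coordinates of the queries and keys: the normalized constant. -/
noncomputable def normOne (p : ℕ) (tk : ℕ → Token α r) (i : ℕ) : ℝ :=
  trunc p (1 / scaleAt p tk i)

/-- The inner product of the query at position `i` and the key at position `j`. -/
noncomputable def dotAt (p : ℕ) (tk : ℕ → Token α r) (i j : ℕ) : ℝ :=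
  trunc p (normFreq p (· = Token.bos) tk i * normFreq p (· = Token.bos) tk j) +
  trunc p (normFreq p (· = Token.bos) tk i * normFreq p (fun v => ¬ v.IsInput) tk j) +
  trunc p (normFreq p (fun v => ¬ v.IsInput) tk i * normOne p tk j) -
  if (tk j).IsInput then 0 else trunc p (trunc p (4 * normOne p tk i) * normOne p tk j)

theorem stepLayer_dot_counted [Fintype α] (hp : 7 ≤ p / 2 - 1) (M : DFA α (Fin r))
    (tk : ℕ → Token α r) (i j : ℕ) :
    (stepLayer M).dot p (counted p tk 0 0 i) (counted p tk 0 0 j) = dotAt p tk i j :=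
  stepLayer_dot hp M _ _ (freq_mem _ _ _) (freq_mem _ _ _) (freq_mem _ _ _) (freq_mem _ _ _)
    _ _ _ _ _ _

section Norm

variable (S : Token α r → Prop) (tk : ℕ → Token α r) {i j : ℕ}

theorem normOne_mem (hp : 7 ≤ p / 2 - 1) (hi : i < 2 ^ (p / 2 - 1)) :
    1 / 4 ≤ normOne p tk i ∧ normOne p tk i ≤ 1 / 2 :=
  trunc_one_div_mem hp (scaleAt_mem tk hp hi).1 (scaleAt_mem tk hp hi).2

theorem normFreq_mem (hp : 7 ≤ p / 2 - 1) (hi : i < 2 ^ (p / 2 - 1)) :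
    0 ≤ normFreq p S tk i ∧ normFreq p S tk i ≤ normOne p tk i := by
  have h := (scaleAt_mem tk hp hi).1
  exact ⟨trunc_nonneg (div_nonneg (freq_nonneg _ _) (by linarith)),
    trunc_mono p (div_le_div_of_nonneg_right (freq_le_one _ _ hi) (by linarith))⟩

theorem dotAt_nonneg (hp : 7 ≤ p / 2 - 1) (hi : i < 2 ^ (p / 2 - 1)) (hj : j < 2 ^ (p / 2 - 1))
    (h : (tk j).IsInput) : 0 ≤ dotAt p tk i j := by
  have h1 := fun S => (normFreq_mem (p := p) S tk hp hi).1
  have h2 := fun S => (normFreq_mem (p := p) S tk hp hj).1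
  have h3 := (normOne_mem tk hp hj).1
  rw [dotAt, if_pos h, sub_zero]
  exact add_nonneg (add_nonneg (trunc_nonneg (mul_nonneg (h1 _) (h2 _)))
    (trunc_nonneg (mul_nonneg (h1 _) (h2 _)))) (trunc_nonneg (mul_nonneg (h1 _) (by linarith)))

/-- Positions that do not hold an input token are penalized. -/
theorem dotAt_le_of_not_isInput (hp : 7 ≤ p / 2 - 1) (hi : i < 2 ^ (p / 2 - 1))
    (hj : j < 2 ^ (p / 2 - 1)) (h : ¬ (tk j).IsInput) :
    dotAt p tk i j ≤ -(1 / 16) + 2 * err p := by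
  rw [dotAt, if_neg h]
  have h1 := fun S => normFreq_mem (p := p) S tk hp hi
  have h2 := fun S => normFreq_mem (p := p) S tk hp hj
  obtain ⟨h3, h3'⟩ := normOne_mem tk hp hi
  obtain ⟨h4, h4'⟩ := normOne_mem tk hp hj
  have key : ∀ x y, 0 ≤ x → x ≤ normOne p tk i → 0 ≤ y → y ≤ normOne p tk j →
      trunc p (x * y) ≤ normOne p tk i * normOne p tk j := fun x y hx hx' hy hy' =>
    (trunc_le (mul_nonneg hx hy)).trans (mul_le_mul hx' hy' hy (by linarith))
  have e1 := key _ _ (h1 (· = Token.bos)).1 (h1 _).2 (h2 (· = Token.bos)).1 (h2 _).2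
  have e2 := key _ _ (h1 (· = Token.bos)).1 (h1 _).2 (h2 (fun v => ¬ v.IsInput)).1 (h2 _).2
  have e3 := key _ _ (h1 (fun v => ¬ v.IsInput)).1 (h1 _).2 (by linarith) (le_refl (normOne p tk j))
  -- The three positive terms are at most `g * g'` each and the penalty is about `4 * g * g'`, which
  -- leaves at most `-(g * g') ≤ -1/16` up to truncation.
  set g := normOne p tk i
  set g' := normOne p tk j
  have hgg : 1 / 4 * (1 / 4) ≤ g * g' := mul_le_mul h3 h4 (by norm_num) (by linarith)
  have hgg' : g * g' ≤ 1 / 2 * (1 / 2) := mul_le_mul h3' h4' (by linarith) (by norm_num)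
  have f1 : 4 * g - err p ≤ trunc p (4 * g) := sub_err_le_trunc hp (by linarith) (by linarith)
  have f1' : trunc p (4 * g) ≤ 4 * g := trunc_le (by linarith)
  have f0 : 0 ≤ trunc p (4 * g) := trunc_nonneg (by linarith)
  have f2 : (4 * g - err p) * g' ≤ trunc p (4 * g) * g' :=
    mul_le_mul_of_nonneg_right f1 (by linarith)
  have f2' : trunc p (4 * g) * g' ≤ 2 * (1 / 2) :=
    mul_le_mul (by linarith) h4' (by linarith) (by norm_num)
  have f3 : trunc p (4 * g) * g' - err p ≤ trunc p (trunc p (4 * g) * g') :=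
    sub_err_le_trunc hp (mul_nonneg f0 (by linarith)) (by linarith)
  have f4 : err p * g' ≤ err p * 1 := mul_le_mul_of_nonneg_left (by linarith) (err_pos p).le
  linarith

theorem abs_dotAt_le (hp : 7 ≤ p / 2 - 1) (hi : i < 2 ^ (p / 2 - 1))
    (hj : j < 2 ^ (p / 2 - 1)) : |dotAt p tk i j| ≤ 10 := by
  have o1 := normOne_mem tk hp hi
  have o2 := normOne_mem tk hp hj
  have n1 := fun S => normFreq_mem (p := p) S tk hp hi
  have n2 := fun S => normFreq_mem (p := p) S tk hp hj
  have key : ∀ x y : ℝ, 0 ≤ x ∧ x ≤ 2 → 0 ≤ y ∧ y ≤ 1 →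
      0 ≤ trunc p (x * y) ∧ trunc p (x * y) ≤ 2 := fun x y hx hy =>
    ⟨trunc_nonneg (mul_nonneg hx.1 hy.1), (trunc_le (mul_nonneg hx.1 hy.1)).trans
      ((mul_le_mul hx.2 hy.2 hy.1 (by norm_num)).trans (by norm_num))⟩
  have b1 : ∀ S, 0 ≤ normFreq p S tk i ∧ normFreq p S tk i ≤ 2 := fun S =>
    ⟨(n1 S).1, by linarith [(n1 S).2]⟩
  have b2 : ∀ S, 0 ≤ normFreq p S tk j ∧ normFreq p S tk j ≤ 1 := fun S =>
    ⟨(n2 S).1, by linarith [(n2 S).2]⟩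
  have b3 : 0 ≤ normOne p tk j ∧ normOne p tk j ≤ 1 := ⟨by linarith, by linarith⟩
  have b4 : 0 ≤ trunc p (4 * normOne p tk i) ∧ trunc p (4 * normOne p tk i) ≤ 2 :=
    ⟨trunc_nonneg (by linarith), (trunc_le (by linarith)).trans (by linarith)⟩
  obtain ⟨k1, k1'⟩ := key _ _ (b1 (· = Token.bos)) (b2 (· = Token.bos))
  obtain ⟨k2, k2'⟩ := key _ _ (b1 (· = Token.bos)) (b2 fun v => ¬ v.IsInput)
  obtain ⟨k3, k3'⟩ := key _ _ (b1 fun v => ¬ v.IsInput) b3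
  obtain ⟨k4, k4'⟩ := key _ _ b4 b3
  rw [dotAt, abs_le]
  split_ifs <;> constructor <;> linarith

end Norm

/-- Truncating the numerators costs `2 * err p`. After division by `μ = trunc p √m`, a gap above `2
* err p` must remain; since `μ ≤ m`, this accounts for `2 * m * err p`. -/
theorem score_lt_score (hp : 7 ≤ p / 2 - 1) {m : ℕ} (hm : 1 ≤ m) {x y : ℝ} (hx : |x| ≤ 10)
    (hy : |y| ≤ 10) (hxy : x + (2 + 2 * m) * err p < y) :
    trunc p (trunc p x / trunc p √(m : ℝ)) < trunc p (trunc p y / trunc p √(m : ℝ)) := by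
  have hδ := err_pos p
  have hm1 : (1 : ℝ) ≤ m := by exact_mod_cast hm
  have hμ1 : 1 ≤ trunc p √(m : ℝ) := le_trunc (one_mem_floats hp) (Real.one_le_sqrt.2 hm1)
  have hμm : trunc p √(m : ℝ) ≤ m := (trunc_le (Real.sqrt_nonneg _)).trans
    ((Real.sqrt_le_left (by linarith)).2 (by nlinarith))
  generalize trunc p √(m : ℝ) = μ at hμ1 hμm
  have hdiv : ∀ z : ℝ, |z| ≤ 10 → |trunc p z / μ| < 2 ^ 7 := by
    intro z hz
    have h2 := abs_trunc_sub_le hp (hz.trans_lt (by norm_num))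
    have h3 : err p ≤ 1 := by
      rw [err, div_le_one (by positivity)]
      exact pow_le_pow_right₀ (by norm_num) hp
    rw [abs_div, abs_of_pos (by linarith : 0 < μ)]
    refine (div_le_self (abs_nonneg _) hμ1).trans_lt ?_
    have := abs_sub_abs_le_abs_sub (trunc p z) z
    linarith
  refine trunc_lt_trunc hp (hdiv x hx) (hdiv y hy) ?_
  rw [← sub_div, lt_div_iff₀ (by linarith)]
  have h2 := (abs_le.1 (abs_trunc_sub_le hp (hx.trans_lt (by norm_num)))).2
  have h3 := (abs_le.1 (abs_trunc_sub_le hp (hy.trans_lt (by norm_num)))).1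
  have h4 : 2 * err p * μ ≤ 2 * err p * m := mul_le_mul_of_nonneg_left hμm (by linarith)
  linarith

namespace Trace

variable {tk : ℕ → Token α r} {n s : ℕ}

theorem freq_bos (h : Trace tk n s) {i : ℕ} (h1 : 1 ≤ i) (hi : i ≤ n + s) :
    freq p (· = Token.bos) tk i = weight p i := by
  rw [freq, h.countBefore_bos h1 hi, Nat.cast_one, one_mul, weight, trunc_trunc]

theorem freq_other_of_le (h : Trace tk n s) {i : ℕ} (h1 : 1 ≤ i) (hi : i ≤ n) :
    freq p (fun v => ¬ v.IsInput) tk i = weight p i := by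
  rw [freq, h.countBefore_other_of_le h1 hi, Nat.cast_one, one_mul, weight, trunc_trunc]

/-- The normalized frequencies at the last position. -/
theorem query_estimate (hp : 7 ≤ p / 2 - 1) (tk : ℕ → Token α r) (S : Token α r → Prop) {i : ℕ}
    (hi : i < 2 ^ (p / 2 - 1)) :
    |normFreq p S tk i - countBefore S tk i * (1 / i) / scaleAt p tk i| ≤
      (countBefore S tk i + 2) * err p := by
  obtain ⟨h1, h2⟩ := freq_estimate S tk hp hi
  have hρ := (scaleAt_mem tk hp hi).1
  have hρ0 : 0 < scaleAt p tk i := by linarith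
  have hf0 : 0 ≤ freq p S tk i / scaleAt p tk i := div_nonneg (freq_nonneg S tk) hρ0.le
  have hf1 : freq p S tk i / scaleAt p tk i ≤ 1 :=
    (div_le_one hρ0).2 ((freq_le_one S tk hi).trans (by linarith))
  have e1 : normFreq p S tk i ≤ freq p S tk i / scaleAt p tk i := trunc_le hf0
  have e2 : freq p S tk i / scaleAt p tk i - err p ≤ normFreq p S tk i :=
    sub_err_le_trunc hp hf0 (by linarith)
  have e3 := div_le_div_of_nonneg_right h1 hρ0.le
  have e4 := div_le_div_of_nonneg_right h2 hρ0.le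
  rw [sub_div] at e4
  have hc : 0 ≤ (countBefore S tk i + 1) * err p := mul_nonneg (by positivity) (err_pos p).le
  have e5 : (countBefore S tk i + 1) * err p / scaleAt p tk i ≤ (countBefore S tk i + 1) * err p :=
    div_le_self hc (by linarith)
  rw [abs_le]
  constructor <;> linarith [err_pos p]

/-- Each product costs the error of the query, that of the key and one truncation: twice `3 + 2 + 1`
for the `$`-frequency, and `(s + 2) + 2 + 1` for the non-input frequency. -/
theorem dotAt_estimate (h : Trace tk n s) (hp : 7 ≤ p / 2 - 1) (hs : 1 ≤ s)
    (hi : n + s < 2 ^ (p / 2 - 1)) {j : ℕ} (hj : 1 ≤ j) (hjn : j ≤ n) :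
    |dotAt p tk (n + s) j - 1 / ((n + s : ℕ) : ℝ) / scaleAt p tk (n + s) / 2 *
      ((2 + s * j) / √((j : ℝ) ^ 2 + 2))| ≤ (s + 17) * err p := by
  have hj' : j < 2 ^ (p / 2 - 1) := by omega
  have hin : (tk j).IsInput := (h.isInput_iff (by omega)).2 ⟨hj, hjn⟩
  have hsc : scaleAt p tk j = attnScale p (weight p j) (weight p j) := by
    rw [scaleAt, h.freq_bos hj (by omega), h.freq_other_of_le hj hjn]
  obtain ⟨k1, k2⟩ := key_estimate hp hj hj'
  have hb : normFreq p (· = Token.bos) tk j =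
      trunc p (weight p j / attnScale p (weight p j) (weight p j)) := by
    rw [normFreq, hsc, h.freq_bos hj (by omega)]
  have ho : normFreq p (fun v => ¬ v.IsInput) tk j =
      trunc p (weight p j / attnScale p (weight p j) (weight p j)) := by
    rw [normFreq, hsc, h.freq_other_of_le hj hjn]
  have h1 : normOne p tk j = trunc p (1 / attnScale p (weight p j) (weight p j)) := by
    rw [normOne, hsc]
  rw [← hb] at k1
  rw [← h1] at k2
  have q1 := query_estimate hp tk (· = Token.bos) hi
  have q2 := query_estimate hp tk (fun v => ¬ v.IsInput) hi
  rw [h.countBefore_bos (by omega) le_rfl, Nat.cast_one, one_mul] at q1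
  rw [h.countBefore_other hs] at q2
  rw [dotAt, if_pos hin, sub_zero, ho, ← hb]
  have hj1 : (1 : ℝ) ≤ j := by exact_mod_cast hj
  have hY : (j : ℝ) ≤ √((j : ℝ) ^ 2 + 2) := Real.le_sqrt_of_sq_le (by linarith)
  have b1 : 1 / (2 * √((j : ℝ) ^ 2 + 2)) ≤ 1 := (div_le_one (by positivity)).2 (by linarith)
  have b2 : j / (2 * √((j : ℝ) ^ 2 + 2)) ≤ 1 := (div_le_one (by positivity)).2 (by linarith)
  have n1 := normFreq_mem (p := p) (· = Token.bos) tk hp hi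
  have n2 := normFreq_mem (p := p) (fun v => ¬ v.IsInput) tk hp hi
  have n3 := normFreq_mem (p := p) (· = Token.bos) tk hp hj'
  have o1 := normOne_mem tk hp hi
  have o2 := normOne_mem tk hp hj'
  have t1 := abs_trunc_mul_sub_le hp n1.1 (by linarith) n3.1 (by linarith) (by positivity) b1 q1 k1
  have t2 := abs_trunc_mul_sub_le hp n2.1 (by linarith) (by linarith) (by linarith) (by positivity)
    b2 q2 k2
  have e : 1 / ((n + s : ℕ) : ℝ) / scaleAt p tk (n + s) / 2 *
      ((2 + s * j) / √((j : ℝ) ^ 2 + 2)) =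
      1 / ((n + s : ℕ) : ℝ) / scaleAt p tk (n + s) * (1 / (2 * √((j : ℝ) ^ 2 + 2))) +
      1 / ((n + s : ℕ) : ℝ) / scaleAt p tk (n + s) * (1 / (2 * √((j : ℝ) ^ 2 + 2))) +
      s * (1 / ((n + s : ℕ) : ℝ)) / scaleAt p tk (n + s) * (j / (2 * √((j : ℝ) ^ 2 + 2))) := by
    field_simp
    ring
  rw [e]
  rw [abs_le] at t1 t2 ⊢
  constructor <;> linarith [t1.1, t1.2, t2.1, t2.2]

/-- The key at position `s` is the best match for the query at position `n + s`. -/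
theorem dotAt_gap (h : Trace tk n s) (hs : 1 ≤ s) {N K m : ℕ} (hP : Precise p N K)
    (hN : 2 * n + 2 ≤ N) (hK : 8 * (40 + 2 * m) ≤ K) (hi : n + s < 2 ^ (p / 2 - 1)) {j : ℕ}
    (hj : j < n + s) (hjs : j ≠ s) :
    dotAt p tk (n + s) j + (2 + 2 * m) * err p < dotAt p tk (n + s) s := by
  have hp := hP.le_bits
  have hsn := h.le
  have hN2 : (2 : ℝ) ≤ N := by exact_mod_cast hP.two_le
  have hN0 : (0 : ℝ) < N := by linarith
  have hδ := err_pos p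
  have hKR : 8 * (40 + 2 * (m : ℝ)) ≤ K := by exact_mod_cast hK
  have hm : (0 : ℝ) ≤ m := Nat.cast_nonneg m
  -- The total error is `2 * (s + 17)` from the two estimates plus the required `2 + 2 * m`. The
  -- margin is `1 / N ^ 3` from `direction_gap` times the query's scale, at least `1 / (8 * N)`.
  have hmain : (2 * (N : ℝ) + 36 + 2 * m) * err p < 1 / (8 * N ^ 4) := by
    rw [lt_div_iff₀ (by positivity)]
    have h1 : 2 * (N : ℝ) + 36 + 2 * m ≤ (40 + 2 * m) * N := by nlinarith
    calc (2 * (N : ℝ) + 36 + 2 * m) * err p * (8 * N ^ 4)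
        ≤ ((40 + 2 * m) * N) * err p * (8 * N ^ 4) := by gcongr
      _ = (8 * (40 + 2 * m)) * N ^ 5 * err p := by ring
      _ ≤ K * N ^ 5 * err p := by gcongr
      _ < 1 := hP.err_lt
  have hsN : (s : ℝ) ≤ N := by exact_mod_cast (by omega : s ≤ N)
  by_cases hin : (tk j).IsInput
  · obtain ⟨hj1, hjn⟩ := (h.isInput_iff hj.le).1 hin
    have g := direction_gap (N := N) hs hj1 (by omega) (by omega) hjs
    have d1 := (abs_le.1 (h.dotAt_estimate hp hs hi hj1 hjn)).2
    have d2 := (abs_le.1 (h.dotAt_estimate hp hs hi hs hsn)).1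
    set c := 1 / ((n + s : ℕ) : ℝ) / scaleAt p tk (n + s) / 2 with hc
    have hc0 : 1 / (8 * (N : ℝ)) ≤ c := by
      have hρ := scaleAt_mem tk hp hi
      rw [hc, div_div, div_div]
      refine one_div_le_one_div_of_le ?_ ?_
      · have : (0 : ℝ) < (n + s : ℕ) := by exact_mod_cast (by omega : 0 < n + s)
        have : 0 < scaleAt p tk (n + s) := by linarith [hρ.1]
        positivity
      · have h2 : ((n + s : ℕ) : ℝ) ≤ N := by exact_mod_cast (by omega : n + s ≤ N)
        have h3 : ((n + s : ℕ) : ℝ) * scaleAt p tk (n + s) ≤ N * 4 :=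
          mul_le_mul h2 hρ.2 (by linarith [hρ.1]) hN0.le
        linarith
    have hc1 : 0 ≤ c := le_trans (by positivity) hc0
    have g1 := mul_le_mul_of_nonneg_left g hc1
    rw [mul_add] at g1
    have g2 : 1 / (8 * (N : ℝ)) * (1 / N ^ 3) ≤ c * (1 / N ^ 3) :=
      mul_le_mul_of_nonneg_right hc0 (by positivity)
    have g3 : 1 / (8 * (N : ℝ)) * (1 / N ^ 3) = 1 / (8 * N ^ 4) := by
      field_simp
    have g4 : (s : ℝ) * err p ≤ N * err p := mul_le_mul_of_nonneg_right hsN hδ.le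
    linarith
  · have d1 := dotAt_le_of_not_isInput tk hp hi (by omega : j < 2 ^ (p / 2 - 1)) hin
    have d2 := dotAt_nonneg tk hp hi (by omega : s < 2 ^ (p / 2 - 1))
      ((h.isInput_iff (by omega)).2 ⟨hs, hsn⟩)
    have h3 : 1 / (8 * (N : ℝ) ^ 4) ≤ 1 / 16 := by
      refine one_div_le_one_div_of_le (by norm_num) ?_
      have : (2 : ℝ) ^ 4 ≤ N ^ 4 := pow_le_pow_left₀ (by norm_num) hN2 4
      linarith
    have h4 : 0 ≤ N * err p := by positivity
    linarith

theorem stepLayer_attended [Fintype α] {k : ℕ} (h : Trace tk n s) (hs : 1 ≤ s) {N K : ℕ}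
    (hP : Precise p N K) (hN : 2 * n + 2 ≤ N)
    (hK : 8 * (40 + 2 * blockDim k (RegCoord α r)) ≤ K) (hi : n + s < 2 ^ (p / 2 - 1))
    (M : DFA α (Fin r)) (H : ℕ → Fin (blockDim k (RegCoord α r)) → ℝ)
    (hH : ∀ j ≤ n + s, (fun b => H j (coord k b)) = counted p tk 0 0 j) :
    ((stepLayer M).toLayer k).attended p H 0 (n + s) = {s} := by
  have hp := hP.le_bits
  have hsn := h.le
  have hm : 1 ≤ blockDim k (RegCoord α r) :=
    Nat.add_pos_right _ (Fintype.card_pos_iff.2 ⟨(bosFreq, 0)⟩)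
  have hscore : ∀ j ≤ n + s, ((stepLayer M).toLayer k).score p 0 (H (n + s)) (H j) =
      trunc p (trunc p (dotAt p tk (n + s) j) / trunc p √(blockDim k (RegCoord α r) : ℝ)) := by
    intro j hj
    rw [BlockLayer.score_toLayer, hH _ le_rfl, hH j hj, stepLayer_dot_counted hp]
  have hlt : ∀ j < n + s, j ≠ s →
      ((stepLayer M).toLayer k).score p 0 (H (n + s)) (H j) <
        ((stepLayer M).toLayer k).score p 0 (H (n + s)) (H s) := by
    intro j hj hjs
    rw [hscore j hj.le, hscore s (by omega)]
    exact score_lt_score hp hm (abs_dotAt_le tk hp hi (by omega))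
      (abs_dotAt_le tk hp hi (by omega)) (h.dotAt_gap hs hP hN hK hi hj hjs)
  ext j
  rw [TransformerLayer.attended, Finset.mem_filter, Finset.mem_singleton, Finset.mem_range]
  constructor
  · rintro ⟨hj, hmax⟩
    by_contra hjs
    exact absurd (hmax s (Finset.mem_range.2 (by omega))) (not_le.2 (hlt j hj hjs))
  · rintro rfl
    refine ⟨by omega, fun j' hj' => ?_⟩
    by_cases hjs : j' = j
    · rw [hjs]
    · exact (hlt j' (Finset.mem_range.1 hj') hjs).le

end Trace

/-! ### Logarithmic precision suffices -/

theorem Precise.lt {N K : ℕ} (h : Precise p N K) (hK : 1 ≤ K) : N < 2 ^ (p / 2 - 1) := by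
  have h1 := h.err_lt
  have hK' : (1 : ℝ) ≤ K := by exact_mod_cast hK
  have hN : (1 : ℝ) ≤ N := by exact_mod_cast (by linarith [h.two_le] : 1 ≤ N)
  rw [err, ← mul_div_assoc, div_lt_one (by positivity)] at h1
  have h2 : (N : ℝ) ≤ N ^ 5 := le_self_pow₀ hN (by norm_num)
  have h3 : (N : ℝ) ^ 5 ≤ K * N ^ 5 := le_mul_of_one_le_left (by positivity) hK'
  have h4 : (N : ℝ) < 2 ^ (p / 2 - 1) := by nlinarith
  exact_mod_cast h4

theorem Precise.mul_err_lt {N K : ℕ} (h : Precise p N K) : (K : ℝ) * err p < 1 := by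
  have hN : (1 : ℝ) ≤ N := by exact_mod_cast (by linarith [h.two_le] : 1 ≤ N)
  have h2 : (1 : ℝ) ≤ N ^ 5 := one_le_pow₀ hN
  have h3 : (K : ℝ) * err p * 1 ≤ K * err p * N ^ 5 :=
    mul_le_mul_of_nonneg_left h2 (mul_nonneg (Nat.cast_nonneg _) (err_pos p).le)
  linarith [h.err_lt]

/-- A multiple of `log₂ N` bits is precise enough. -/
theorem exists_precise (K : ℕ) : ∃ c : ℕ, ∀ n : ℕ,
    Precise (c * Nat.log 2 ((n + 1) + (n + 1))) ((n + 1) + (n + 1)) K := by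
  -- With `l = log₂ N ≥ 1` and `N ≤ 2 ^ (l + 1)`, it is enough that `K + 5 * (l + 1) + 8 ≤ (18 + K)
  -- * l`. The summand `8` comes from the `2 ^ 7` in `err` and the bit lost in `p / 2 - 1`.
  refine ⟨2 * (18 + K), fun n => ?_⟩
  set N := (n + 1) + (n + 1) with hN
  set l := Nat.log 2 N with hl
  have hl1 : 1 ≤ l := Nat.log_pos (by norm_num) (by omega)
  have hNl : N ≤ 2 ^ (l + 1) := (Nat.lt_pow_succ_log_self (by norm_num) N).le
  have hp : 2 * (18 + K) * l / 2 - 1 = (18 + K) * l - 1 := by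
    rw [mul_assoc, Nat.mul_div_cancel_left _ (by norm_num)]
  have hbig : 18 ≤ (18 + K) * l := by nlinarith
  refine ⟨by omega, by omega, ?_⟩
  rw [err, hp, ← mul_div_assoc, div_lt_one (by positivity)]
  have h1 : K * N ^ 5 * 2 ^ 7 * 2 < 2 ^ ((18 + K) * l) := by
    calc K * N ^ 5 * 2 ^ 7 * 2 = K * (N ^ 5 * 2 ^ 8) := by ring
      _ < 2 ^ K * (N ^ 5 * 2 ^ 8) :=
        Nat.mul_lt_mul_of_pos_right Nat.lt_two_pow_self (by positivity)
      _ ≤ 2 ^ K * ((2 ^ (l + 1)) ^ 5 * 2 ^ 8) := by gcongr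
      _ = 2 ^ (K + ((l + 1) * 5 + 8)) := by rw [← pow_mul, ← pow_add, ← pow_add]
      _ ≤ 2 ^ ((18 + K) * l) := Nat.pow_le_pow_right (by norm_num) (by nlinarith)
  have h2 : (2 : ℕ) ^ ((18 + K) * l) = 2 ^ ((18 + K) * l - 1) * 2 := by
    rw [← pow_succ]
    congr 1
    omega
  rw [h2] at h1
  have h3 := Nat.lt_of_mul_lt_mul_right h1
  exact_mod_cast h3

/-! ### Detecting the end of the input -/

/-- The frequencies decide whether the whole input has been read. -/
noncomputable def progress (p : ℕ) (tk : ℕ → Token α r) (i : ℕ) : ℝ :=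
  trunc p (2 * freq p Token.IsInput tk i) - trunc p (2 * freq p (fun v => ¬ v.IsInput) tk i) -
    freq p (· = Token.bos) tk i

theorem progress_mem (tk : ℕ → Token α r) {i : ℕ} (hi : i < 2 ^ (p / 2 - 1)) :
    -3 ≤ progress p tk i ∧ progress p tk i ≤ 2 := by
  have h0 := fun S => freq_nonneg (p := p) S tk (i := i)
  have h1 := fun S => freq_le_one (p := p) S tk hi
  have e1 := trunc_le (p := p) (by linarith [h0 Token.IsInput] : 0 ≤ 2 * freq p Token.IsInput tk i)
  have e2 := trunc_nonneg (p := p)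
    (by linarith [h0 Token.IsInput] : 0 ≤ 2 * freq p Token.IsInput tk i)
  have e3 := trunc_le (p := p)
    (by linarith [h0 fun v => ¬ v.IsInput] : 0 ≤ 2 * freq p (fun v => ¬ v.IsInput) tk i)
  have e4 := trunc_nonneg (p := p)
    (by linarith [h0 fun v => ¬ v.IsInput] : 0 ≤ 2 * freq p (fun v => ¬ v.IsInput) tk i)
  rw [progress]
  constructor <;> linarith [h0 (· = Token.bos), h1 (· = Token.bos), h1 Token.IsInput,
    h1 fun v => ¬ v.IsInput]

namespace Trace

variable {tk : ℕ → Token α r} {n s : ℕ}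

/-- For `s = n` the two counts agree, so their truncated frequencies cancel exactly. What remains is
minus the frequency of `$`, which is nonzero at this precision. -/
theorem progress_neg (h : Trace tk n s) (hs : 1 ≤ s) (hsn : s = n) {N K : ℕ} (hP : Precise p N K)
    (hK : 1 ≤ K) (hN : 2 * n + 2 ≤ N) : progress p tk (n + s) < 0 := by
  have hi : n + s < 2 ^ (p / 2 - 1) := by have := hP.lt hK; omega
  have hw := le_weight hP.le_bits hi
  have h1 : 1 / ((n + s : ℕ) : ℝ) > err p := by
    have hpos : (0 : ℝ) < (n + s : ℕ) := by exact_mod_cast (by omega : 0 < n + s)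
    rw [gt_iff_lt, lt_div_iff₀ hpos]
    have h2 : ((n + s : ℕ) : ℝ) ≤ N := by exact_mod_cast (by omega : n + s ≤ N)
    have hN1 : (1 : ℝ) ≤ N := by exact_mod_cast (by omega : 1 ≤ N)
    have h3 : (N : ℝ) ≤ K * N ^ 5 := (le_self_pow₀ hN1 (by norm_num)).trans
      (le_mul_of_one_le_left (by positivity) (by exact_mod_cast hK))
    calc err p * (n + s : ℕ) ≤ err p * (K * N ^ 5) :=
          mul_le_mul_of_nonneg_left (h2.trans h3) (err_pos p).le
      _ < 1 := by linarith [hP.err_lt]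
  rw [progress, h.freq_bos (by omega) le_rfl, freq, freq, h.countBefore_input hs,
    h.countBefore_other hs, hsn] at *
  linarith

/-- The exact value is at least `1/(n + s)`. The bound is `err p` rather than `0` because the sum
with the state's activation is truncated again in the logit. -/
theorem progress_pos (h : Trace tk n s) (hs : 1 ≤ s) (hsn : s < n) {N K : ℕ} (hP : Precise p N K)
    (hK : 7 ≤ K) (hN : 2 * n + 2 ≤ N) : err p < progress p tk (n + s) := by
  have hp := hP.le_bits
  have hi : n + s < 2 ^ (p / 2 - 1) := by have := hP.lt (by omega); omega
  have hδ := err_pos p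
  obtain ⟨-, e1⟩ := freq_estimate Token.IsInput tk hp hi
  obtain ⟨e2, -⟩ := freq_estimate (fun v => ¬ v.IsInput) tk hp hi
  rw [h.countBefore_input hs] at e1
  rw [h.countBefore_other hs] at e2
  have e3 := weight_le hi
  have f1 := sub_err_le_trunc hp (x := 2 * freq p Token.IsInput tk (n + s))
    (by linarith [freq_nonneg (p := p) Token.IsInput tk (i := n + s)])
    (by linarith [freq_le_one Token.IsInput tk hi])
  have f2 := trunc_le (p := p) (x := 2 * freq p (fun v => ¬ v.IsInput) tk (n + s))
    (by linarith [freq_nonneg (p := p) (fun v => ¬ v.IsInput) tk (i := n + s)])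
  rw [progress, h.freq_bos (by omega) le_rfl]
  have hpos : (0 : ℝ) < (n + s : ℕ) := by exact_mod_cast (by omega : 0 < n + s)
  have hsn' : (s : ℝ) + 1 ≤ n := by exact_mod_cast hsn
  have hN' : 2 * (n : ℝ) + 2 ≤ N := by exact_mod_cast hN
  have hnsN : ((n + s : ℕ) : ℝ) ≤ N := by exact_mod_cast (by omega : n + s ≤ N)
  have hn0 : (0 : ℝ) ≤ s := Nat.cast_nonneg s
  have hN1 : (1 : ℝ) ≤ N := by linarith
  have hv : 0 < 1 / ((n + s : ℕ) : ℝ) := by positivity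
  -- Twice the frequency error `n + 1`, one truncation, and the `err p` in the conclusion.
  have hmain : (2 * n + 4) * err p < 1 / ((n + s : ℕ) : ℝ) := by
    rw [lt_div_iff₀ hpos]
    have h1 : (2 * (n : ℝ) + 4) * (n + s : ℕ) ≤ (3 * N) * N :=
      mul_le_mul (by linarith) hnsN hpos.le (by positivity)
    have h2 : (3 * (N : ℝ)) * N ≤ K * N ^ 5 := by
      have h3 : (N : ℝ) ^ 2 ≤ N ^ 5 := pow_le_pow_right₀ hN1 (by norm_num)
      have h4 : (3 : ℝ) ≤ K := by exact_mod_cast (by omega : 3 ≤ K)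
      calc (3 * (N : ℝ)) * N = 3 * N ^ 2 := by ring
        _ ≤ K * N ^ 5 := mul_le_mul h4 h3 (by positivity) (by positivity)
    calc (2 * n + 4) * err p * (n + s : ℕ) = err p * ((2 * n + 4) * (n + s : ℕ)) := by ring
      _ ≤ err p * (K * N ^ 5) := mul_le_mul_of_nonneg_left (h1.trans h2) hδ.le
      _ < 1 := by linarith [hP.err_lt]
  set v := 1 / ((n + s : ℕ) : ℝ)
  have h5 : (s + 1) * v ≤ n * v := mul_le_mul_of_nonneg_right hsn' hv.le
  linarith

end Trace

/-! ### The generated word -/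

/-- The token at position `j` of a word. -/
def tokenAt (u : List (Token α r)) (j : ℕ) : Token α r := u.getD j Token.bos

/-- The word after `s` decoding steps. -/
def runWord (M : DFA α (Fin r)) (x : List α) (s : ℕ) : List (Token α r) :=
  Token.bos :: x.map Token.input ++ (List.range s).map fun t => Token.aux (M.eval (x.take t))

section Run

variable (M : DFA α (Fin r)) (x : List α)

theorem length_runWord (s : ℕ) : (runWord M x s).length = x.length + s + 1 := by
  simp [runWord]

theorem tokenAt_runWord_input (s : ℕ) {j : ℕ} (h1 : 1 ≤ j) (hj : j ≤ x.length) :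
    tokenAt (runWord M x s) j = Token.input x[j - 1] := by
  obtain ⟨j, rfl⟩ := Nat.exists_eq_add_of_le' h1
  have : j < x.length := by omega
  simp [tokenAt, runWord, List.getElem?_append, this]

theorem tokenAt_runWord_aux {s j : ℕ} (hj : j < s) :
    tokenAt (runWord M x s) (x.length + (j + 1)) = Token.aux (M.eval (x.take j)) := by
  rw [← add_assoc]
  simp [tokenAt, runWord, hj]

theorem trace_runWord {s : ℕ} (hs : s ≤ x.length) :
    Trace (tokenAt (runWord M x s)) x.length s where
  le := hs
  bos := rfl
  input j h1 hj := ⟨_, tokenAt_runWord_input M x s h1 hj⟩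
  aux j h1 hj := by
    obtain ⟨t, rfl⟩ := Nat.exists_eq_add_of_lt h1
    exact ⟨_, tokenAt_runWord_aux M x (by omega)⟩

end Run

/-! ### The retrieved symbol and the transition -/

theorem symbol_mem (hp : 7 ≤ p / 2 - 1) (tk : ℕ → Token α r) {j : ℕ} (hj : j < 2 ^ (p / 2 - 1)) :
    1 ≤ trunc p (4 * trunc p (1 / scaleAt p tk j)) ∧
      trunc p (4 * trunc p (1 / scaleAt p tk j)) ≤ 2 := by
  obtain ⟨h1, h2⟩ := normOne_mem tk hp hj
  rw [normOne] at h1 h2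
  exact ⟨le_trunc (one_mem_floats hp) (by linarith), (trunc_le (by linarith)).trans (by linarith)⟩

/-- An average of numbers in `[0, 2]` whose truncated weights sum to at most `1`. The set is
arbitrary, possibly empty, because these bounds are needed before the attended set is known. -/
theorem lookup_mem (hp : 7 ≤ p / 2 - 1) (tk : ℕ → Token α r) {S : Finset ℕ} {i : ℕ}
    (hS : S ⊆ Finset.range i) (hi : i < 2 ^ (p / 2 - 1)) (x : α) :
    0 ≤ lookup p tk S x ∧ lookup p tk S x ≤ 2 := by
  have hcard : S.card ≤ i := by simpa using Finset.card_le_card hS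
  have hw : trunc p (1 / trunc p (S.card : ℝ)) = weight p S.card := rfl
  have hv : ∀ j ∈ S, 0 ≤ (if tk j = Token.input x then
      trunc p (4 * trunc p (1 / scaleAt p tk j)) else 0) ∧ (if tk j = Token.input x then
      trunc p (4 * trunc p (1 / scaleAt p tk j)) else 0) ≤ 2 := by
    intro j hj
    have hji := Finset.mem_range.1 (hS hj)
    have := symbol_mem hp tk (hji.trans hi)
    split_ifs
    · constructor <;> linarith
    · constructor <;> norm_num
  have hterm0 : ∀ j ∈ S, 0 ≤ trunc p (weight p S.card * if tk j = Token.input x then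
      trunc p (4 * trunc p (1 / scaleAt p tk j)) else 0) := fun j hj =>
    trunc_nonneg (mul_nonneg (weight_nonneg p _) (hv j hj).1)
  have hterm : ∀ j ∈ S, trunc p (weight p S.card * if tk j = Token.input x then
      trunc p (4 * trunc p (1 / scaleAt p tk j)) else 0) ≤ 1 / S.card * 2 := fun j hj =>
    (trunc_le (mul_nonneg (weight_nonneg p _) (hv j hj).1)).trans
      (mul_le_mul (weight_le (hcard.trans_lt hi)) (hv j hj).2 (hv j hj).1 (by positivity))
  rw [lookup, hw]
  refine ⟨trunc_nonneg (Finset.sum_nonneg hterm0), (trunc_le (Finset.sum_nonneg hterm0)).trans ?_⟩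
  refine (Finset.sum_le_sum hterm).trans ?_
  rw [Finset.sum_const, nsmul_eq_mul, ← mul_assoc, mul_one_div]
  nlinarith [div_self_le_one (S.card : ℝ)]

theorem lookup_singleton (hp : 7 ≤ p / 2 - 1) (tk : ℕ → Token α r) {s : ℕ} {a : α}
    (ha : tk s = Token.input a) :
    lookup p tk {s} = Pi.single a (trunc p (4 * trunc p (1 / scaleAt p tk s))) := by
  funext x
  by_cases hx : x = a
  · subst hx
    simp [lookup, ha, trunc_one hp]
  · have : a ≠ x := fun h => hx h.symm
    simp [lookup, ha, this, hx]

variable [Fintype α]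

theorem two_le_ffScale (hp : 7 ≤ p / 2 - 1) (y : α → ℝ) : 2 ≤ ffScale p y := by
  have h0 : 0 ≤ ∑ x, trunc p (y x * y x) :=
    Finset.sum_nonneg fun x _ => trunc_nonneg (mul_self_nonneg _)
  refine le_trunc (ofNat_mem_floats hp 2 (by norm_num)) (Real.le_sqrt_of_sq_le ?_)
  exact le_trans (by norm_num) (le_trunc (f := 4) (ofNat_mem_floats hp 4 (by norm_num))
    (by linarith))

theorem ffScale_le {y : α → ℝ} {B D : ℝ} (hB : ∑ x, trunc p (y x * y x) ≤ B) (hD : 0 ≤ D)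
    (hBD : 4 * (1 + B) ≤ D ^ 2) : ffScale p y ≤ D := by
  have h0 : 0 ≤ ∑ x, trunc p (y x * y x) :=
    Finset.sum_nonneg fun x _ => trunc_nonneg (mul_self_nonneg _)
  refine (trunc_le (Real.sqrt_nonneg _)).trans ((Real.sqrt_le_left hD).2 ?_)
  exact (trunc_le (by linarith)).trans (by linarith)

theorem ffScale_le_card {y : α → ℝ} (hy0 : ∀ x, 0 ≤ y x) (hy2 : ∀ x, y x ≤ 2) :
    ffScale p y ≤ 4 * (1 + Fintype.card α) := by
  have hc : (0 : ℝ) ≤ Fintype.card α := Nat.cast_nonneg _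
  refine ffScale_le (B := 4 * Fintype.card α) ?_ (by positivity) (by nlinarith)
  calc ∑ x, trunc p (y x * y x) ≤ ∑ _x : α, 4 := by
        refine Finset.sum_le_sum fun x _ => (trunc_le (mul_self_nonneg _)).trans ?_
        nlinarith [mul_self_le_mul_self (hy0 x) (hy2 x)]
    _ = 4 * Fintype.card α := by simp [mul_comm]

theorem err_lt_of_precise {N K : ℕ} (hP : Precise p N K) (hK : 16 * (1 + Fintype.card α) ≤ K)
    {y : α → ℝ} (hy0 : ∀ x, 0 ≤ y x) (hy2 : ∀ x, y x ≤ 2) : 4 * err p < 1 / ffScale p y := by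
  have h2 := two_le_ffScale hP.le_bits y
  rw [lt_div_iff₀ (by linarith)]
  have h3 : 4 * err p * ffScale p y ≤ 4 * err p * (4 * (1 + Fintype.card α)) :=
    mul_le_mul_of_nonneg_left (ffScale_le_card hy0 hy2) (by linarith [err_pos p])
  have hK' : 16 * (1 + (Fintype.card α : ℝ)) ≤ K := by exact_mod_cast hK
  have h4 : 16 * (1 + (Fintype.card α : ℝ)) * err p ≤ K * err p :=
    mul_le_mul_of_nonneg_right hK' (err_pos p).le
  linarith [hP.mul_err_lt]

/-- The transition function is applied to the current state and the retrieved symbol. -/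
theorem nextState_aux (hp : 7 ≤ p / 2 - 1) (M : DFA α (Fin r)) (q : Fin r) (a : α) {σ : ℝ}
    (h1 : 1 ≤ σ) (h2 : σ ≤ 2) : ∃ Y ∈ floats p, 8 ≤ Y ∧ Y ≤ 64 ∧
      nextState p M (Token.aux q) (Pi.single a σ) = Pi.single (M.step q a) Y := by
  have hsum : ∑ x, trunc p ((Pi.single a σ : α → ℝ) x * (Pi.single a σ : α → ℝ) x) ≤ 4 := by
    rw [Fintype.sum_eq_single a]
    · rw [Pi.single_eq_same]
      exact (trunc_le (mul_self_nonneg _)).trans (by nlinarith)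
    · intro x hx
      simp [hx]
  have s2 := two_le_ffScale hp (Pi.single a σ : α → ℝ)
  -- Since `4 * (1 + 4) ≤ 8 ^ 2`. Hence the open gate lies in `[1/8, 1]`, and the weight `64` lifts
  -- it to `[8, 64]`, clear of the progress term and still below `2 ^ 7`.
  have s8 : ffScale p (Pi.single a σ : α → ℝ) ≤ 8 :=
    ffScale_le hsum (by norm_num) (by norm_num)
  set ρ := ffScale p (Pi.single a σ : α → ℝ) with hρ
  have m8 : (1 / 8 : ℝ) ∈ floats p := by
    have := one_div_pow_mem_floats hp (a := 3) (by norm_num)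
    norm_num at this ⊢; exact this
  have g1 : 1 / 8 ≤ trunc p (σ / ρ) := le_trunc m8 (div_le_div₀ (by linarith) h1 (by linarith) s8)
  have g2 : trunc p (σ / ρ) ≤ 1 :=
    (trunc_le (div_nonneg (by linarith) (by linarith))).trans
      ((div_le_one (by linarith)).2 (by linarith))
  have h64 : trunc p (64 : ℝ) = 64 := trunc_ofNat hp 64 (by norm_num)
  refine ⟨trunc p (64 * trunc p (σ / ρ)), trunc_mem _ _,
    le_trunc (ofNat_mem_floats hp 8 (by norm_num)) (by linarith),
    (trunc_le (by linarith)).trans (by linarith), ?_⟩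
  funext q'
  rw [nextState, ← hρ, Fintype.sum_eq_single (q, a)]
  · by_cases hq : M.step q a = q'
    · subst hq
      simp [h64]
    · have : q' ≠ M.step q a := fun h => hq h.symm
      simp [hq, this]
  · rintro ⟨q₁, a₁⟩ hne
    by_cases hq : q₁ = q
    · subst hq
      have : a₁ ≠ a := fun h => hne (by rw [h])
      simp [this]
    · have : q ≠ q₁ := fun h => hq h.symm
      simp [this]

/-- Every gate needs its state as the current token. In the first decoding step all are closed, and
only the bias of `outRow` acts. -/
theorem nextState_of_ne_aux (M : DFA α (Fin r)) {u : Token α r} (hu : ∀ q, u ≠ Token.aux q)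
    (y : α → ℝ) : nextState p M u y = 0 := by
  funext q
  simp [nextState, hu]

/-! ### The hidden states and the logits -/

variable {k : ℕ} (pe : ℕ → Fin k → ℝ) (M : DFA α (Fin r))

theorem embedWord_recognizer (hp : 7 ≤ p / 2 - 1) (u : List (Token α r)) {j : ℕ}
    (hj : j < u.length) : (fun b => (recognizer pe M).embedWord p u j (coord k b)) =
      ofParts 0 0 0 (oneHot (tokenAt u j) 1) 0 0 := by
  funext b
  have h1 : tokenAt u j = u[j] := by simp [tokenAt, hj]
  have h0 : (recognizer pe M).embedWord p u j (coord k b) =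
      trunc p (trunc p ((recognizer pe M).emb u[j] (coord k b) : ℝ) +
        trunc p ((recognizer pe M).pos j (coord k b))) := by
    rw [Transformer.embedWord, dif_pos hj]
    rfl
  rw [h0, h1]
  have h2 : (recognizer pe M).pos j (coord k b) = 0 := dif_neg (not_coord_lt b)
  have h3 : (recognizer pe M).emb u[j] (coord k b) = tokRow (Pi.single u[j] 1) b := by
    simp [recognizer, liftRow, coord]
  rw [h2, h3, trunc_zero, add_zero, trunc_trunc]
  cases b with
  | tok v =>
    by_cases hv : v = u[j]
    · simp [tokRow, ofParts, oneHot, hv, trunc_one hp]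
    · simp [tokRow, ofParts, oneHot, hv]
  | _ => simp [tokRow, ofParts]

theorem logit_recognizer (u : List (Token α r)) (v : Token α r) :
    (recognizer pe M).logit p u v = rowEval p (outRow M v) fun b =>
      (recognizer pe M).hidden p u (u.length - 1) (coord k b) :=
  rowEval_liftRow (outRow M v) _

/-- The attended set `S` is left abstract so that one statement serves the first decoding step,
where `S` is irrelevant, and the later ones, where it is `{s}`. -/
theorem hidden_recognizer (hp : 7 ≤ p / 2 - 1) (u : List (Token α r)) (hu : u ≠ []) {N K : ℕ}
    (hP : Precise p N K) (hK : 16 * (1 + Fintype.card α) ≤ K) (hN : u.length ≤ N) :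
    ∃ S ⊆ Finset.range (u.length - 1), (∀ {n s : ℕ}, Trace (tokenAt u) n s → 1 ≤ s →
        u.length = n + s + 1 → 2 * n + 2 ≤ N → 8 * (40 + 2 * blockDim k (RegCoord α r)) ≤ K →
        S = {s}) ∧
      (fun b => (recognizer pe M).hidden p u (u.length - 1) (coord k b)) =
        counted p (tokenAt u) (lookup p (tokenAt u) S)
          (nextState p M (tokenAt u (u.length - 1)) (lookup p (tokenAt u) S)) (u.length - 1) := by
  set i := u.length - 1 with hi
  have hlen : 0 < u.length := List.length_pos_iff.2 hu
  have hiN : i < 2 ^ (p / 2 - 1) := by have := hP.lt (by omega); omega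
  set H := ((countLayer α r).toLayer k).apply p ((recognizer pe M).embedWord p u) with hH
  have hH1 : ∀ j ≤ i, (fun b => H j (coord k b)) = counted p (tokenAt u) 0 0 j := by
    intro j hj
    exact countLayer_apply hp _ _ _ fun j' hj' => embedWord_recognizer pe M hp u (by omega)
  have hsub : ((stepLayer M).toLayer k).attended p H 0 i ⊆ Finset.range i :=
    Finset.filter_subset _ _
  refine ⟨((stepLayer M).toLayer k).attended p H 0 i, hsub, ?_, ?_⟩
  · intro n s ht hs hus hnN hK'
    have his : i = n + s := by omega
    rw [his] at hH1 hiN ⊢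
    exact ht.stepLayer_attended hs hP hnN hK' hiN M H hH1
  · have hl := fun x => lookup_mem hp (tokenAt u) hsub hiN x
    exact stepLayer_apply hp M H _ i hH1 rfl (fun x => (hl x).1) (fun x => (hl x).2)
      (two_le_ffScale hp _) (err_lt_of_precise hP hK (fun x => (hl x).1) fun x => (hl x).2)

theorem rowEval_outRow_aux (hp : 7 ≤ p / 2 - 1) (M : DFA α (Fin r)) (q : Fin r)
    (tk : ℕ → Token α r) (y : α → ℝ) {z : Fin r → ℝ} (hz : z q ∈ floats p) (i : ℕ) :
    rowEval p (outRow M (Token.aux q)) (counted p tk y z i) =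
      trunc p (progress p tk i + (if q = M.start ∧ ((tk i).IsInput ∨
        tk i = Token.bos ∧ M.start ∉ M.accept) then 32 else 0) + z q) := by
  have h2 : trunc p (2 : ℝ) = 2 := trunc_ofNat hp 2 (by norm_num)
  have h32 : trunc p (32 : ℝ) = 32 := trunc_ofNat hp 32 (by norm_num)
  have hA := trunc_of_mem (freq_mem (p := p) (· = Token.bos) tk i)
  rw [outRow, counted, rowEval_ofParts, sum_oneHot (tk i) 1 fun v x => trunc p
    (trunc p ((if q = M.start ∧ (v.IsInput ∨ v = Token.bos ∧ M.start ∉ M.accept) then 32 else 0 : ℚ)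
      : ℝ) * x), Fintype.sum_eq_single q (f := fun q' : Fin r => trunc p (trunc p _ * _))]
  · congr 1
    rw [progress]
    by_cases h : q = M.start ∧ ((tk i).IsInput ∨ tk i = Token.bos ∧ M.start ∉ M.accept)
    · rw [if_pos h, if_pos h]
      simp [h2, h32, hA, trunc_one hp, trunc_of_mem hz]
      ring
    · rw [if_neg h, if_neg h]
      simp [h2, hA, trunc_one hp, trunc_of_mem hz]
      ring
  · intro q' hq
    simp [hq]
  · simp

theorem rowEval_outRow_accept (hp : 7 ≤ p / 2 - 1) (M : DFA α (Fin r)) (tk : ℕ → Token α r)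
    (y : α → ℝ) (z : Fin r → ℝ) (i : ℕ) :
    rowEval p (outRow M Token.accept) (counted p tk y z i) =
      trunc p ((if tk i = Token.bos ∧ M.start ∈ M.accept then 32 else 0) +
        ∑ q, trunc p (if q ∈ M.accept then z q else 0)) := by
  have h32 : trunc p (32 : ℝ) = 32 := trunc_ofNat hp 32 (by norm_num)
  rw [outRow, counted, rowEval_ofParts, sum_oneHot (tk i) 1 fun v x => trunc p
    (trunc p ((if v = Token.bos ∧ M.start ∈ M.accept then 32 else 0 : ℚ) : ℝ) * x)]
  · have e : ∀ q, trunc p (trunc p ((if q ∈ M.accept then 1 else 0 : ℚ) : ℝ) * z q) =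
        trunc p (if q ∈ M.accept then z q else 0) := by
      intro q
      split_ifs <;> simp [trunc_one hp]
    rw [Finset.sum_congr rfl fun q _ => e q]
    congr 1
    by_cases h : tk i = Token.bos ∧ M.start ∈ M.accept
    · rw [if_pos h, if_pos h]; simp [h32]
    · rw [if_neg h, if_neg h]; simp
  · simp

theorem rowEval_outRow_bos (M : DFA α (Fin r)) (x : RegCoord α r → ℝ) :
    rowEval p (outRow M Token.bos) x = 0 := by simp [outRow]

theorem rowEval_outRow_input (M : DFA α (Fin r)) (a : α) (x : RegCoord α r → ℝ) :
    rowEval p (outRow M (Token.input a)) x = 0 := by simp [outRow]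

/-! ### Decoding -/

theorem Transformer.next_eq_of_forall_lt {V : Type*} [Finite V] [Nonempty V] (T : Transformer V)
    (p : ℕ) (u : List V) (v : V) (h : ∀ v', v' ≠ v → T.logit p u v' < T.logit p u v) :
    T.next p u = v := by
  by_contra hne
  exact absurd ((Finite.exists_max (T.logit p u)).choose_spec v) (not_le.2 (h _ hne))

/-- The constant that governs the precision. -/
noncomputable def precisionConst (k : ℕ) (α : Type*) [Fintype α] (r : ℕ) : ℕ :=
  8 * (40 + 2 * blockDim k (RegCoord α r)) + 16 * (1 + Fintype.card α)

section Next

variable {k : ℕ} (pe : ℕ → Fin k → ℝ) (M : DFA α (Fin r)) (u : List (Token α r)) {N : ℕ}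

theorem next_of_isInput (hP : Precise p N (precisionConst k α r)) (hu : u ≠ []) (hN : u.length ≤ N)
    (h : (tokenAt u (u.length - 1)).IsInput) :
    (recognizer pe M).next p u = Token.aux M.start := by
  have hp := hP.le_bits
  have hK : 16 * (1 + Fintype.card α) ≤ precisionConst k α r := Nat.le_add_left _ _
  obtain ⟨S, -, -, hS⟩ := hidden_recognizer pe M hp u hu hP hK hN
  have hlen : 0 < u.length := List.length_pos_iff.2 hu
  have hi : u.length - 1 < 2 ^ (p / 2 - 1) := by
    have := hP.lt (by omega)
    omega
  have hpr := progress_mem (tokenAt u) hi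
  have hz : nextState p M (tokenAt u (u.length - 1)) (lookup p (tokenAt u) S) = 0 := by
    refine nextState_of_ne_aux M (fun q hq => ?_) _
    rw [hq] at h
    exact h
  rw [hz] at hS
  have hnb : tokenAt u (u.length - 1) ≠ Token.bos := by
    intro hb
    rw [hb] at h
    exact h
  -- The bias `32` minus at most `3` from the progress term; all other logits are at most `2`.
  have hstart : 29 ≤ (recognizer pe M).logit p u (Token.aux M.start) := by
    rw [logit_recognizer, hS, rowEval_outRow_aux hp M _ _ _ (zero_mem_floats p),
      if_pos ⟨rfl, Or.inl h⟩]
    exact le_trunc (ofNat_mem_floats hp 29 (by norm_num)) (by simp; linarith)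
  refine Transformer.next_eq_of_forall_lt _ _ _ _ fun v hv => lt_of_lt_of_le ?_ hstart
  rw [logit_recognizer, hS]
  cases v with
  | bos => rw [rowEval_outRow_bos]; norm_num
  | input a => rw [rowEval_outRow_input]; norm_num
  | accept => rw [rowEval_outRow_accept hp]; simp [hnb]
  | aux q =>
    have hq : q ≠ M.start := fun h => hv (by rw [h])
    rw [rowEval_outRow_aux hp M _ _ _ (zero_mem_floats p), if_neg fun h => hq h.1]
    refine (trunc_le_of_le (ofNat_mem_floats hp 2 (by norm_num)) ?_).trans_lt
      (by norm_num : (2 : ℝ) < 29)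
    simp
    linarith

theorem next_bos (hP : Precise p N (precisionConst k α r)) :
    (recognizer pe M).next p [Token.bos] =
      if M.start ∈ M.accept then Token.accept else Token.aux M.start := by
  have hp := hP.le_bits
  have hK : 16 * (1 + Fintype.card α) ≤ precisionConst k α r := Nat.le_add_left _ _
  obtain ⟨S, -, -, hS⟩ := hidden_recognizer pe M hp [Token.bos] (by simp) hP hK
    (by simpa using (by linarith [hP.two_le] : 1 ≤ N))
  have hb : tokenAt ([Token.bos] : List (Token α r)) 0 = Token.bos := rfl
  have hpr := progress_mem (p := p) (tokenAt ([Token.bos] : List (Token α r))) (i := 0)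
    (by positivity)
  have hz : nextState p M (Token.bos) (lookup p (tokenAt ([Token.bos] : List (Token α r))) S) = 0 :=
    nextState_of_ne_aux M (by simp) _
  have hni : ¬ (Token.bos : Token α r).IsInput := fun h => h
  rw [List.length_singleton, Nat.sub_self, hb, hz] at hS
  generalize lookup p (tokenAt ([Token.bos] : List (Token α r))) S = y at hS
  have h32 : trunc p (32 : ℝ) = 32 := trunc_ofNat hp 32 (by norm_num)
  have hsmall : trunc p (progress p (tokenAt ([Token.bos] : List (Token α r))) 0) ≤ 2 :=
    trunc_le_of_le (ofNat_mem_floats hp 2 (by norm_num)) hpr.2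
  have hlogit : ∀ v, (recognizer pe M).logit p [Token.bos] v = rowEval p (outRow M v)
      (counted p (tokenAt [Token.bos]) y 0 0) := by
    intro v
    rw [← hS]
    exact logit_recognizer pe M _ v
  split_ifs with hacc
  · have hl : (recognizer pe M).logit p [Token.bos] Token.accept = 32 := by
      rw [hlogit, rowEval_outRow_accept hp, hb, if_pos ⟨rfl, hacc⟩]
      simp [h32]
    refine Transformer.next_eq_of_forall_lt _ _ _ _ fun v hv => ?_
    rw [hl, hlogit]
    cases v with
    | bos => rw [rowEval_outRow_bos]; norm_num
    | input a => rw [rowEval_outRow_input]; norm_num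
    | accept => exact absurd rfl hv
    | aux q =>
      rw [rowEval_outRow_aux hp M _ _ _ (zero_mem_floats p), hb, if_neg (by simp [hni, hacc])]
      simp
      linarith
  · have hl : 29 ≤ (recognizer pe M).logit p [Token.bos] (Token.aux M.start) := by
      rw [hlogit, rowEval_outRow_aux hp M _ _ _ (zero_mem_floats p), hb,
        if_pos ⟨rfl, Or.inr ⟨rfl, hacc⟩⟩]
      exact le_trunc (ofNat_mem_floats hp 29 (by norm_num)) (by simp; linarith)
    refine Transformer.next_eq_of_forall_lt _ _ _ _ fun v hv => lt_of_lt_of_le ?_ hl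
    rw [hlogit]
    cases v with
    | bos => rw [rowEval_outRow_bos]; norm_num
    | input a => rw [rowEval_outRow_input]; norm_num
    | accept => rw [rowEval_outRow_accept hp, hb]; simp [hacc]
    | aux q =>
      have hq : q ≠ M.start := fun h => hv (by rw [h])
      rw [rowEval_outRow_aux hp M _ _ _ (zero_mem_floats p), hb, if_neg fun h => hq h.1]
      simp
      linarith

/-- Let `q'` be the new state, `Y ≥ 8` its activation and `E` the progress. The logit of `q'` is
about `Y + E`; that of the accept token is `Y` if `q'` accepts and `0` otherwise. So the sign of `E`
decides between them when `q'` accepts. -/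
theorem next_of_trace (hP : Precise p N (precisionConst k α r)) {n s : ℕ}
    (ht : Trace (tokenAt u) n s) (hs : 1 ≤ s) (hu : u.length = n + s + 1) (hN : 2 * n + 2 ≤ N)
    {q : Fin r} {a : α} (hq : tokenAt u (n + s) = Token.aux q)
    (ha : tokenAt u s = Token.input a) :
    (recognizer pe M).next p u = if s = n ∧ M.step q a ∈ M.accept then Token.accept
      else Token.aux (M.step q a) := by
  have hp := hP.le_bits
  have hδ := err_pos p
  have hsn := ht.le
  have hK : 16 * (1 + Fintype.card α) ≤ precisionConst k α r := Nat.le_add_left _ _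
  have hK7 : 7 ≤ precisionConst k α r := by unfold precisionConst; omega
  have hi : n + s < 2 ^ (p / 2 - 1) := by
    have := hP.lt (by omega)
    omega
  obtain ⟨S, -, hSs, hS⟩ := hidden_recognizer pe M hp u (List.ne_nil_of_length_pos (by omega)) hP hK
    (by omega)
  rw [hSs ht hs hu hN (Nat.le_add_right _ _), show u.length - 1 = n + s by omega, hq,
    lookup_singleton hp _ ha] at hS
  obtain ⟨σ1, σ2⟩ := symbol_mem hp (tokenAt u) (by omega : s < 2 ^ (p / 2 - 1))
  obtain ⟨Y, hYm, hY8, hY64, hY⟩ := nextState_aux hp M q a σ1 σ2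
  rw [hY] at hS
  generalize (Pi.single a (trunc p (4 * trunc p (1 / scaleAt p (tokenAt u) s))) : α → ℝ) = y at hS
  set q' := M.step q a with hq'
  set E := progress p (tokenAt u) (n + s) with hE
  have hpr : -3 ≤ E ∧ E ≤ 2 := progress_mem (tokenAt u) hi
  have hni : ¬ (Token.aux q : Token α r).IsInput := fun h => h
  have hlogit : ∀ v, (recognizer pe M).logit p u v = rowEval p (outRow M v)
      (counted p (tokenAt u) y (Pi.single q' Y) (n + s)) := by
    intro v
    rw [← hS, logit_recognizer, show u.length - 1 = n + s by omega]
  have hsingle : ∀ q₁, (Pi.single q' Y : Fin r → ℝ) q₁ ∈ floats p := by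
    intro q₁
    by_cases h : q₁ = q'
    · subst h; simpa using hYm
    · simpa [h] using zero_mem_floats p
  have haux : ∀ q₁, (recognizer pe M).logit p u (Token.aux q₁) =
      trunc p (E + (Pi.single q' Y : Fin r → ℝ) q₁) := by
    intro q₁
    rw [hlogit, rowEval_outRow_aux hp M _ _ _ (hsingle q₁), hq, if_neg (by simp [hni]), add_zero]
  have haux_ne : ∀ q₁ ≠ q', (recognizer pe M).logit p u (Token.aux q₁) ≤ 2 := by
    intro q₁ h
    rw [haux]
    simp only [Pi.single_eq_of_ne h, add_zero]
    exact trunc_le_of_le (ofNat_mem_floats hp 2 (by norm_num)) hpr.2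
  have haux_eq : (recognizer pe M).logit p u (Token.aux q') = trunc p (E + Y) := by
    rw [haux, Pi.single_eq_same]
  have hge : 5 ≤ trunc p (E + Y) := le_trunc (ofNat_mem_floats hp 5 (by norm_num)) (by linarith)
  have haccept : (recognizer pe M).logit p u Token.accept = if q' ∈ M.accept then Y else 0 := by
    rw [hlogit, rowEval_outRow_accept hp, hq, if_neg (by simp), zero_add,
      Fintype.sum_eq_single q']
    · rw [trunc_trunc, Pi.single_eq_same]
      split_ifs
      · exact trunc_of_mem hYm
      · exact trunc_zero p
    · intro q₁ h
      simp [h]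
  split_ifs with hacc
  · refine Transformer.next_eq_of_forall_lt _ _ _ _ fun v hv => ?_
    rw [haccept, if_pos hacc.2]
    cases v with
    | bos => rw [hlogit, rowEval_outRow_bos]; linarith
    | input a => rw [hlogit, rowEval_outRow_input]; linarith
    | accept => exact absurd rfl hv
    | aux q₁ =>
      by_cases h : q₁ = q'
      · rw [h, haux_eq]
        have hneg : E < 0 := ht.progress_neg hs hacc.1 hP (by omega) hN
        exact (trunc_le (by linarith)).trans_lt (by linarith)
      · linarith [haux_ne q₁ h]
  · refine Transformer.next_eq_of_forall_lt _ _ _ _ fun v hv => ?_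
    rw [haux_eq]
    cases v with
    | bos => rw [hlogit, rowEval_outRow_bos]; linarith
    | input a => rw [hlogit, rowEval_outRow_input]; linarith
    | accept =>
      rw [haccept]
      split_ifs with h
      -- An accepting state is reached before the end of the input. Here `E > err p` keeps the
      -- truncated `E + Y` strictly above `Y`.
      · have hlt : s < n := lt_of_le_of_ne hsn fun h' => hacc ⟨h', h⟩
        have hpos : err p < E := ht.progress_pos hs hlt hP hK7 hN
        have := sub_err_le_trunc hp (x := E + Y) (by linarith) (by linarith)
        linarith
      · linarith
    | aux q₁ =>
      have h : q₁ ≠ q' := fun h => hv (by rw [h])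
      linarith [haux_ne q₁ h]

end Next

section Run

variable (M : DFA α (Fin r)) (x : List α)

/-- The last token separates three situations: `$` for the empty input, an input token in the first
step on a nonempty input, and a state afterwards. -/
theorem next_runWord {k : ℕ} (pe : ℕ → Fin k → ℝ) {N : ℕ}
    (hP : Precise p N (precisionConst k α r)) (hN : 2 * x.length + 2 ≤ N) {s : ℕ}
    (hs : s ≤ x.length) :
    (recognizer pe M).next p (runWord M x s) = if s = x.length ∧ M.eval (x.take s) ∈ M.accept
      then Token.accept else Token.aux (M.eval (x.take s)) := by
  rcases Nat.eq_zero_or_pos s with rfl | h0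
  · rcases Nat.eq_zero_or_pos x.length with hx | hx
    · obtain rfl := List.length_eq_zero_iff.1 hx
      simpa [runWord] using next_bos pe M hP
    · rw [if_neg (by omega)]
      refine next_of_isInput pe M _ hP (by simp [runWord]) (by rw [length_runWord]; omega) ?_
      rw [length_runWord, add_zero, Nat.add_sub_cancel, tokenAt_runWord_input M x 0 hx le_rfl]
      trivial
  · have hstep : M.eval (x.take s) = M.step (M.eval (x.take (s - 1))) x[s - 1] := by
      rw [← DFA.eval_append_singleton]
      congr 1
      rw [List.take_append_getElem, Nat.sub_add_cancel h0]
    rw [hstep]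
    refine next_of_trace pe M _ hP (trace_runWord M x hs) h0 (length_runWord M x s) hN ?_
      (tokenAt_runWord_input M x s h0 hs)
    have := tokenAt_runWord_aux M x (Nat.sub_lt h0 one_pos)
    rwa [show s - 1 + 1 = s by omega] at this

theorem decode_recognizer {k : ℕ} (pe : ℕ → Fin k → ℝ) {N : ℕ}
    (hP : Precise p N (precisionConst k α r)) (hN : 2 * x.length + 2 ≤ N) {s : ℕ}
    (hs : s ≤ x.length) :
    (recognizer pe M).decode p s (Token.bos :: x.map Token.input) = runWord M x s := by
  induction s with
  | zero => simp [Transformer.decode, runWord]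
  | succ s ih =>
    rw [Transformer.decode, ih (by omega), next_runWord M x pe hP hN (by omega),
      -- The accept token is possible only in the step from `s = x.length`, so this prefix consists
      -- of states.
      if_neg (by omega)]
    simp [runWord, List.range_succ]

end Run

theorem recognizer_recognizes {k : ℕ} (pe : ℕ → Fin k → ℝ) (M : DFA α (Fin r)) :
    ∃ c, (recognizer pe M).RecognizesInLinearSteps c M.accepts := by
  obtain ⟨c, hc⟩ := exists_precise (precisionConst k α r)
  refine ⟨c, fun x => ?_⟩
  have hP := hc x.length
  rw [Transformer.decode, decode_recognizer M x pe hP (by omega) le_rfl,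
    next_runWord M x pe hP (by omega) le_rfl, List.take_length, List.getLast?_append]
  simp [DFA.mem_accepts]

theorem hasPositionalEncoding_recognizer {k : ℕ} (pe : ℕ → Fin k → ℝ) (M : DFA α (Fin r)) :
    (recognizer pe M).HasPositionalEncoding pe :=
  ⟨Nat.le_add_right _ _, fun _ _ => rfl⟩

end Recognizer

/-- A regular language is recognized by an automaton whose states are tokens. -/
theorem Language.IsRegular.exists_dfa_fin {α : Type*} {L : Language α} (hL : L.IsRegular) :
    ∃ (r : ℕ) (M : DFA α (Fin r)), M.accepts = L := by
  obtain ⟨σ, _, M, rfl⟩ := hL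
  exact ⟨_, M.reindex (Fintype.equivFin σ), DFA.accepts_reindex M _⟩

/-- Each regular language is recognized with `|x| + 1` decoding steps by a log-precision decoder-only
projected pre-norm transformer with strict causal saturated attention, both without positional
encodings and in the presence of any given positional encoding. -/
theorem mainTheorem2 {α : Type*} [Finite α] (L : Language α) (hL : L.IsRegular) :
    (∃ (r c : ℕ) (T : Transformer (Token α r)),
      (∀ i t, T.pos i t = 0) ∧ T.RecognizesInLinearSteps c L) ∧
    (∀ (k : ℕ) (pe : ℕ → Fin k → ℝ), ∃ (r c : ℕ) (T : Transformer (Token α r)),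
      T.HasPositionalEncoding pe ∧ T.RecognizesInLinearSteps c L) := by
  have := Fintype.ofFinite α
  obtain ⟨r, M, rfl⟩ := hL.exists_dfa_fin
  constructor
  · obtain ⟨c, hc⟩ := recognizer_recognizes (fun (_ : ℕ) (_ : Fin 0) => (0 : ℝ)) M
    refine ⟨r, c, _, fun i t => ?_, hc⟩
    simp [recognizer]
  · intro k pe
    obtain ⟨c, hc⟩ := recognizer_recognizes pe M
    exact ⟨r, c, _, hasPositionalEncoding_recognizer pe M, hc⟩
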